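/- Let $G$ be a finite group. A (Galois) $G$-algebra over a commutative ring $R$ is an étale $R$-algebra $S$ with a left action of $G$ by $R$-algebra automorphisms such that $\operatorname{Spec} S\to\operatorname{Spec} R$ is an étale $G$-torsor. An element $x\in S$ is normal if $\operatorname{tr}_{S/R}(x)=1$ and $(g(x))_{g\in G}$ is an $R$-basis of $S$; a normal element $x$ is self-dual if $\operatorname{tr}_{S/R}(x\,g(x))=\delta_{g,1}$ for all $g\in G$. Let $\mathcal M_G(R)$ be the set of isomorphism classes of pairs $(S,x)$ with $S$ a $G$-algebra over $R$ and $x\in S$ normal, where an isomorphism $(S,x)\to(S',x')$ is a $G$-equivariant $R$-algebra isomorphism taking $x$ to $x'$. It is a functor of $R$ by base change, and the pairs with $x$ self-dual form a subfunctor $\mathcal M_G^{sd}\subset\mathcal M_G$. Let $\mathbf P(V)=\operatorname{Proj}\mathbf Z[X_g:g\in G]$ be the projective space over $\mathbf Z$ of the regular representation of $G$, on which $g\in G$ acts through $X_h\mapsto X_{hg^{-1}}$. Let $$A=\mathbf Z[X_g:g\in G]\big[\det(X_{gh})^{-1}\big]\Big/\Big(\sum_g X_g-1\Big),\qquad B=A\Big/\Big(\sum_h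 X_{gh}X_h-\delta_{g,1}:g\in G\Big),$$ $U_G=\operatorname{Spec}A$ and $N_G=\operatorname{Spec}B$, with $G$ acting by right multiplication, $X_h\mapsto X_{hg^{-1}}$, and let $U_G\to\mathbf P(V)$ be the morphism with homogeneous coordinates $(X_g)_g$. Then: 1. For every commutative ring $R$, $\varphi\mapsto\sum_g\varphi(X_g)[g]$ identifies $U_G(R)$ with the set of units $u\in R[G]^\times$ of augmentation $1$, and $N_G(R)$ with the set of those that satisfy $u\bar u=1$, where $\overline{\sum_g a_g[g]}=\sum_g a_g[g^{-1}]$. 2. The quotient schemes $\mathbf P(V)/G$, $X_G=U_G/G$ and $Y_G=N_G/G$ exist, where a quotient of a scheme $Z$ by $G$ is a $G$-invariant affine morphism $\pi\colon Z\to Z/G$ such that $\mathcal O_{Z/G}\to(\pi_*\mathcal O_Z)^G$ is an isomorphism. The schemes $X_G$ and $Y_G$ are affine, $U_G\to\mathbf P(V)$ is an open immersion, and there are an open immersion $X_G\to\mathbf P(V)/G$ and a closed immersion $Y_G\to X_G$ compatible with $U_G\to\mathbf P(V)$, with $N_G\subset U_G$ and with the quotient morphisms. In particular $X_G$ and $Y_G$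 are affine subschemes of $\mathbf P(V)/G$. 3. There are bijections $X_G(R)\cong\mathcal M_G(R)$ and $Y_G(R)\cong\mathcal M_G^{sd}(R)$, functorial in the commutative ring $R$, and compatible with $Y_G\to X_G$ and $\mathcal M_G^{sd}\subset\mathcal M_G$. -/

import Mathlib

open CategoryTheory AlgebraicGeometry TensorProduct

noncomputable section

namespace NormalModuli

universe u

/-! ### Galois `G`-algebras and normal elements -/

section GAlgebras

variable (G : Type u) [Group G] (R : Type u) [CommRing R] (S : Type u) [CommRing S] [Algebra R S]
variable [MulSemiringAction G S] [SMulCommClass G R S]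

/-- The comorphism `S ⊗ S → ∏_{g ∈ G} S`, `s ⊗ t ↦ (s · g(t))_g`, of the morphism
`G × Spec S → Spec S ×_{Spec R} Spec S`, `(g, y) ↦ (y, y · g)`. -/
def torsorMap : S ⊗[R] S →ₐ[R] (G → S) :=
  AlgHom.pi fun g : G =>
    Algebra.TensorProduct.productMap (AlgHom.id R S) (MulSemiringAction.toAlgHom R S g)

/-- `S` is a (Galois) `G`-algebra over `R`: it is étale over `R`, and `Spec S → Spec R` is a
`G`-torsor, i.e. a covering (faithfully flat) on which `G` acts simply transitively. -/
structure IsGaloisAlgebra : Prop where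
  etale : Algebra.Etale R S
  faithfullyFlat : Module.FaithfullyFlat R S
  bijective_torsorMap : Function.Bijective (torsorMap G R S)

variable {S}

/-- `x` has trace one and its conjugates `g(x)` form an `R`-basis of `S`. -/
structure IsNormalElement (x : S) : Prop where
  trace_eq_one : Algebra.trace R S x = 1
  linearIndependent : LinearIndependent R (fun g : G => g • x)
  span_eq_top : Submodule.span R (Set.range fun g : G => g • x) = ⊤

/-- The condition `Tr (x · g(x)) = δ_{g,1}` that makes a normal element self-dual. -/
def IsSelfDual [DecidableEq G] (x : S) : Prop :=
  ∀ g : G, Algebra.trace R S (x * g • x) = if g = 1 then 1 else 0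

end GAlgebras

/-! ### Base change -/

section BaseChange

variable {G : Type u} [Group G] {R : Type u} [CommRing R] (R' : Type u) [CommRing R'] [Algebra R R']
variable {S : Type u} [CommRing S] [Algebra R S]
variable [MulSemiringAction G S] [SMulCommClass G R S]

variable (G R S) in
/-- The action of `G` on the second factor of `R' ⊗ S`. -/
@[reducible] def baseChangeAction : MulSemiringAction G (R' ⊗[R] S) where
  smul g := Algebra.TensorProduct.map (AlgHom.id R' R') (MulSemiringAction.toAlgHom R S g)
  one_smul z := by
    change Algebra.TensorProduct.map (AlgHom.id R' R') (MulSemiringAction.toAlgHom R S (1 : G)) z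
      = z
    induction z with
    | zero => simp
    | tmul a s => simp
    | add a b ha hb => rw [map_add, ha, hb]
  mul_smul g h z := by
    change Algebra.TensorProduct.map (AlgHom.id R' R') (MulSemiringAction.toAlgHom R S (g * h)) z
      = Algebra.TensorProduct.map (AlgHom.id R' R') (MulSemiringAction.toAlgHom R S g)
        (Algebra.TensorProduct.map (AlgHom.id R' R') (MulSemiringAction.toAlgHom R S h) z)
    induction z with
    | zero => simp
    | tmul a s => simp [mul_smul]
    | add a b ha hb => rw [map_add, ha, hb, map_add, map_add]
  smul_zero g := map_zero _
  smul_add g := map_add _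
  smul_one g := map_one _
  smul_mul g := map_mul _

attribute [local instance] baseChangeAction

theorem smul_tmul' (g : G) (a : R') (s : S) : g • (a ⊗ₜ[R] s) = a ⊗ₜ[R] (g • s) := by
  change Algebra.TensorProduct.map (AlgHom.id R' R') (MulSemiringAction.toAlgHom R S g) _ = _
  simp

variable (G R S) in
theorem baseChange_smulCommClass : SMulCommClass G R' (R' ⊗[R] S) where
  smul_comm g a z := by
    change Algebra.TensorProduct.map (AlgHom.id R' R') (MulSemiringAction.toAlgHom R S g) (a • z)
      = a • Algebra.TensorProduct.map (AlgHom.id R' R') (MulSemiringAction.toAlgHom R S g) z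
    exact map_smul _ _ _

attribute [local instance] baseChange_smulCommClass

theorem torsorMap_tmul (s t : S) (g : G) : torsorMap G R S (s ⊗ₜ t) g = s * g • t := by
  simp [torsorMap]

theorem IsGaloisAlgebra.baseChange [Fintype G] (h : IsGaloisAlgebra G R S) :
    IsGaloisAlgebra G R' (R' ⊗[R] S) where
  etale := by
    have := h.etale
    infer_instance
  faithfullyFlat := by
    have := h.faithfullyFlat
    infer_instance
  bijective_torsorMap := by
    classical
    let e₁ := TensorProduct.AlgebraTensorModule.distribBaseChange R R' S S
    let e₀ := LinearEquiv.ofBijective (torsorMap G R S).toLinearMap h.bijective_torsorMap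
    let e₂ := e₀.baseChange R R' _ _
    let e₃ := TensorProduct.piRight R R' R' (fun _ : G => S)
    have h₀ (s t : S) : e₀ (s ⊗ₜ t) = torsorMap G R S (s ⊗ₜ t) := rfl
    have key : (torsorMap G R' (R' ⊗[R] S)).toLinearMap ∘ₗ e₁.toLinearMap =
        (e₂ ≪≫ₗ e₃).toLinearMap := by
      ext s t g
      simp [e₁, e₂, e₃, h₀, torsorMap_tmul, smul_tmul']
    have : ⇑(torsorMap G R' (R' ⊗[R] S)) ∘ e₁ = (e₂ ≪≫ₗ e₃) :=
      congrArg DFunLike.coe key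
    rw [← e₁.bijective.of_comp_iff, this]
    exact LinearEquiv.bijective _

theorem trace_baseChange' [Module.Free R S] [Module.Finite R S] (s : S) :
    Algebra.trace R' (R' ⊗[R] S) (1 ⊗ₜ s) = algebraMap R R' (Algebra.trace R S s) := by
  rw [Algebra.trace_apply, Algebra.trace_apply, ← LinearMap.trace_baseChange]
  congr 1
  ext t
  simp

set_option linter.unusedSectionVars false in
theorem IsNormalElement.basis_exists {x : S} (h : IsNormalElement G R x) :
    ∃ b : Module.Basis G R S, ∀ g, b g = g • x :=
  ⟨Module.Basis.mk h.linearIndependent h.span_eq_top.ge, fun g => by simp⟩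

theorem IsNormalElement.free {x : S} (h : IsNormalElement G R x) : Module.Free R S :=
  let ⟨b, _⟩ := h.basis_exists
  Module.Free.of_basis b

theorem IsNormalElement.finite [Finite G] {x : S} (h : IsNormalElement G R x) : Module.Finite R S :=
  let ⟨b, _⟩ := h.basis_exists
  Module.Finite.of_basis b

theorem IsNormalElement.baseChange [Finite G] {x : S} (h : IsNormalElement G R x) :
    IsNormalElement G R' ((1 : R') ⊗ₜ[R] x) := by
  obtain ⟨b, hb⟩ := h.basis_exists
  have hf := h.free
  have hF := h.finite
  have e : (fun g : G => g • ((1 : R') ⊗ₜ[R] x)) = b.baseChange R' := by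
    ext g
    simp [hb, smul_tmul']
  refine ⟨?_, ?_, ?_⟩
  · rw [trace_baseChange', h.trace_eq_one, map_one]
  · rw [e]
    exact (b.baseChange R').linearIndependent
  · rw [e]
    exact (b.baseChange R').span_eq

theorem IsSelfDual.baseChange [Finite G] [DecidableEq G] {x : S} (hn : IsNormalElement G R x) (h : IsSelfDual G R x) :
    IsSelfDual G R' ((1 : R') ⊗ₜ[R] x) := by
  have hf := hn.free
  have hF := hn.finite
  intro g
  rw [smul_tmul', Algebra.TensorProduct.tmul_mul_tmul, one_mul, trace_baseChange', h g]
  split_ifs <;> simp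

end BaseChange

/-! ### The moduli functors -/

section Functors

variable (G : Type u) [Group G]

/-- A pair `(S, x)` of a `G`-algebra `S` over `R` and a normal element `x` of `S`. -/
structure NormalPair (R : Type u) [CommRing R] : Type (u + 1) where
  S : Type u
  [commRing : CommRing S]
  [algebra : Algebra R S]
  [action : MulSemiringAction G S]
  [smulComm : SMulCommClass G R S]
  x : S
  isGalois : IsGaloisAlgebra G R S
  isNormal : IsNormalElement G R x

attribute [instance] NormalPair.commRing NormalPair.algebra NormalPair.action NormalPair.smulComm

variable {G}

/-- Isomorphism of pairs: a `G`-equivariant `R`-algebra isomorphism matching the normal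
elements. -/
def NormalPair.Isomorphic {R : Type u} [CommRing R] (P P' : NormalPair G R) : Prop :=
  ∃ e : P.S ≃ₐ[R] P'.S, (∀ (g : G) (s : P.S), e (g • s) = g • e s) ∧ e P.x = P'.x

variable (G) in
instance NormalPair.setoid (R : Type u) [CommRing R] : Setoid (NormalPair G R) where
  r := NormalPair.Isomorphic
  iseqv :=
    { refl := fun P => ⟨AlgEquiv.refl, fun _ _ => rfl, rfl⟩
      symm := by
        rintro P P' ⟨e, he, hx⟩
        refine ⟨e.symm, fun g s => ?_, ?_⟩
        · apply e.injective
          rw [he, e.apply_symm_apply, e.apply_symm_apply]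
        · rw [← hx, e.symm_apply_apply]
      trans := by
        rintro P P' P'' ⟨e, he, hx⟩ ⟨e', he', hx'⟩
        exact ⟨e.trans e', fun g s => by simp [he, he'], by simp [hx, hx']⟩ }

/-- The base change `(S ⊗ R', x ⊗ 1)` of `(S, x)` along a ring homomorphism `f : R → R'`. -/
def NormalPair.baseChange [Fintype G] {R R' : Type u} [CommRing R] [CommRing R'] (f : R →+* R')
    (P : NormalPair G R) : NormalPair G R' :=
  letI := f.toAlgebra
  letI := baseChangeAction G R R' P.S
  haveI := baseChange_smulCommClass G R R' P.S
  { S := R' ⊗[R] P.S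
    x := 1 ⊗ₜ P.x
    isGalois := P.isGalois.baseChange R'
    isNormal := P.isNormal.baseChange R' }

/-- A pair over `R'` receiving a compatible equivariant ring homomorphism from `(S, x)` is
isomorphic to the base change of `(S, x)`. -/
theorem NormalPair.baseChange_isomorphic [Fintype G] {R R' : Type u} [CommRing R] [CommRing R']
    (f : R →+* R') (P : NormalPair G R) (P' : NormalPair G R') (φ : P.S →+* P'.S)
    (hφ : ∀ r, φ (algebraMap R P.S r) = algebraMap R' P'.S (f r))
    (hG : ∀ (g : G) s, φ (g • s) = g • φ s) (hx : φ P.x = P'.x) :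
    (P.baseChange f).Isomorphic P' := by
  let := f.toAlgebra
  let : Algebra R P'.S := ((algebraMap R' P'.S).comp f).toAlgebra
  have : IsScalarTower R R' P'.S := IsScalarTower.of_algebraMap_eq fun _ => rfl
  let := baseChangeAction G R R' P.S
  let φ' : P.S →ₐ[R] P'.S := { φ with commutes' := hφ }
  let ψ : R' ⊗[R] P.S →ₐ[R'] P'.S :=
    Algebra.TensorProduct.lift (Algebra.ofId R' P'.S) φ' fun _ _ => Commute.all _ _
  have hψ (a : R') (s : P.S) : ψ (a ⊗ₜ s) = algebraMap R' P'.S a * φ s :=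
    Algebra.TensorProduct.lift_tmul ..
  obtain ⟨b, hb⟩ := P.isNormal.basis_exists
  obtain ⟨b', hb'⟩ := P'.isNormal.basis_exists
  have key : ψ.toLinearMap = ((b.baseChange R').equiv b' (Equiv.refl G)).toLinearMap := by
    refine (b.baseChange R').ext fun g => ?_
    have : ((b.baseChange R').equiv b' (Equiv.refl G)) (b.baseChange R' g) = b' g := by
      simp only [Module.Basis.equiv_apply, Equiv.refl_apply]
    rw [LinearEquiv.coe_coe, this]
    simp [hψ, hb, hb', hG, hx]
  have bij : Function.Bijective ψ := by
    have : ⇑ψ = ((b.baseChange R').equiv b' (Equiv.refl G)) := congrArg DFunLike.coe key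
    rw [this]
    exact LinearEquiv.bijective _
  have hψG (g : G) (z : R' ⊗[R] P.S) : ψ (g • z) = g • ψ z := by
    induction z using TensorProduct.induction_on with
    | zero => rw [smul_zero, map_zero, smul_zero]
    | tmul a s => rw [smul_tmul', hψ, hψ, hG, smul_mul', smul_algebraMap]
    | add y z hy hz => rw [smul_add, map_add, hy, hz, map_add, smul_add]
  have hψx : ψ (1 ⊗ₜ P.x) = P'.x := by
    rw [hψ, map_one, one_mul, hx]
  exact ⟨AlgEquiv.ofBijective ψ bij, hψG, hψx⟩

theorem NormalPair.baseChange_map [Fintype G] {R R' : Type u} [CommRing R] [CommRing R']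
    (f : R →+* R') (P : NormalPair G R) :
    ∃ φ : P.S →+* (P.baseChange f).S,
      (∀ r, φ (algebraMap R P.S r) = algebraMap R' (P.baseChange f).S (f r)) ∧
      (∀ (g : G) s, φ (g • s) = g • φ s) ∧ φ P.x = (P.baseChange f).x := by
  let := f.toAlgebra
  let := baseChangeAction G R R' P.S
  refine ⟨(Algebra.TensorProduct.includeRight : P.S →ₐ[R] R' ⊗[R] P.S).toRingHom,
    fun r => ?_, fun g s => ?_, rfl⟩
  · exact (Algebra.TensorProduct.includeRight : P.S →ₐ[R] R' ⊗[R] P.S).commutes r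
  · exact (smul_tmul' R' g 1 s).symm

variable (G) [Fintype G]

/-- The functor `R ↦ {isomorphism classes of pairs (S, x), x normal}`. -/
def normalFunctor : CommRingCat.{u} ⥤ Type (u + 1) where
  obj R := Quotient (NormalPair.setoid G R)
  map f := ↾(Quotient.map (NormalPair.baseChange f.hom) (by
    rintro P P' ⟨e, he, hx⟩
    obtain ⟨φ, h1, h2, h3⟩ := P'.baseChange_map f.hom
    exact P.baseChange_isomorphic f.hom _ (φ.comp (e : P.S →+* P'.S)) (by simp [h1])
      (by simp [he, h2]) (by simp [hx, h3])))
  map_id R := by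
    ext q
    induction q using Quotient.inductionOn with
    | _ P =>
      exact Quotient.sound (P.baseChange_isomorphic _ P (RingHom.id _) (fun _ => rfl)
        (fun _ _ => rfl) rfl)
  map_comp {R R' R''} f f' := by
    ext q
    induction q using Quotient.inductionOn with
    | _ P =>
      obtain ⟨φ, h1, h2, h3⟩ := P.baseChange_map f.hom
      obtain ⟨φ', h1', h2', h3'⟩ := (P.baseChange f.hom).baseChange_map f'.hom
      exact Quotient.sound (P.baseChange_isomorphic _ _ (φ'.comp φ) (by simp [h1, h1'])
        (by simp [h2, h2']) (by simp [h3, h3']))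

/-- The subfunctor of classes of pairs `(S, x)` with `x` self-dual. -/
def selfDualSubfunctor [DecidableEq G] : Subfunctor (normalFunctor G) where
  obj R := {q | ∃ P : NormalPair G R, IsSelfDual G R P.x ∧ Quotient.mk _ P = q}
  map {R R'} f := by
    rintro _ ⟨P, hP, rfl⟩
    exact ⟨P.baseChange f.hom,
      letI := f.hom.toAlgebra
      IsSelfDual.baseChange R' P.isNormal hP, rfl⟩

/-- Self-duality does not depend on the representative of an isomorphism class. -/
theorem mk_mem_selfDualSubfunctor [DecidableEq G] (R : CommRingCat.{u}) (P : NormalPair G R) :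
    (Quotient.mk _ P : (normalFunctor G).obj R) ∈ (selfDualSubfunctor G).obj R ↔
      IsSelfDual G R P.x := by
  refine ⟨?_, fun h => ⟨P, h, rfl⟩⟩
  rintro ⟨P', h, hq⟩ g
  obtain ⟨e, he, hx⟩ := Quotient.exact hq
  rw [← h g, ← hx, ← he, ← map_mul, Algebra.trace_eq_of_algEquiv]

end Functors

/-! ### The schemes `P(V)`, `U_G` and `N_G` with their actions of `G` -/

section Schemes

attribute [local instance] MvPolynomial.gradedAlgebra

variable (G : Type u) [Group G]

/-- The grading of `ℤ[X_g : g ∈ G]` by degree. -/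
abbrev grading : ℕ → Submodule ℤ (MvPolynomial G ℤ) := MvPolynomial.homogeneousSubmodule G ℤ

/-- `P(V)`, the projective space over `ℤ` of the regular representation `V = ℤ[G]`, with
homogeneous coordinates `X_g`, `g ∈ G`. -/
def PV : Scheme.{u} := Proj (grading G)

variable {G} in
/-- The graded ring automorphism `X_h ↦ X_{h g⁻¹}`. -/
def gradedAct (g : G) : GradedRingHom (grading G) (grading G) where
  toRingHom := (MvPolynomial.rename fun h : G => h * g⁻¹ : MvPolynomial G ℤ →ₐ[ℤ] _).toRingHom
  map_mem {_ _} h := MvPolynomial.IsHomogeneous.rename_isHomogeneous h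

variable {G} in
theorem gradedAct_inv_apply (g : G) (x : MvPolynomial G ℤ) :
    gradedAct g (gradedAct g⁻¹ x) = x := by
  change MvPolynomial.rename _ (MvPolynomial.rename _ x) = x
  rw [MvPolynomial.rename_rename]
  convert MvPolynomial.rename_id_apply x
  ext h
  simp

variable {G} in
theorem irrelevant_le_map_gradedAct (g : G) :
    HomogeneousIdeal.irrelevant (grading G) ≤
      (HomogeneousIdeal.irrelevant (grading G)).map (gradedAct g) := by
  rw [HomogeneousIdeal.irrelevant_le]
  intro i hi x hx
  have h := Ideal.mem_map_of_mem (gradedAct g)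
    (HomogeneousIdeal.mem_irrelevant_of_mem (grading G) hi ((gradedAct g⁻¹).map_mem hx))
  exact gradedAct_inv_apply g x ▸ h

variable {G} in
/-- Right multiplication by `g` on `P(V)`. -/
def projAct (g : G) : PV G ⟶ PV G := Proj.map (gradedAct g) (irrelevant_le_map_gradedAct g)

variable [Fintype G] [DecidableEq G]

/-- The group determinant `det (X_{gh})`. -/
def groupDet : MvPolynomial G ℤ := (Matrix.of fun g h : G => MvPolynomial.X (g * h)).det

/-- The coordinate ring `A = ℤ[X_g][1/det(X_{gh})] / (∑ X_g - 1)` of `U_G`. -/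
abbrev UnitRing : Type u :=
  Localization.Away (groupDet G) ⧸
    Ideal.span {∑ g : G, algebraMap (MvPolynomial G ℤ) (Localization.Away (groupDet G))
      (MvPolynomial.X g) - 1}

/-- The natural map `ℤ[X_g] → A`. -/
def toUnitRing : MvPolynomial G ℤ →+* UnitRing G :=
  (Ideal.Quotient.mk _).comp (algebraMap _ _)

variable {G} in
/-- The coordinate functions `X_g` of `U_G`. -/
def coord (g : G) : UnitRing G := toUnitRing G (MvPolynomial.X g)

/-- The coordinate ring `B = A / (∑_h X_{gh} X_h - δ_{g,1})` of `N_G`. -/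
abbrev UnitaryRing : Type u :=
  UnitRing G ⧸ Ideal.span (Set.range fun g : G =>
    ∑ h : G, coord (g * h) * coord h - if g = 1 then 1 else 0)

/-- The natural map `A → B`. -/
def toUnitaryRing : UnitRing G →+* UnitaryRing G := Ideal.Quotient.mk _

/-- The scheme `U_G` of units of augmentation one in the group ring. -/
def UG : Scheme.{u} := Spec (.of (UnitRing G))

/-- The scheme `N_G` of unitary units (`u ū = 1`) of augmentation one in the group ring. -/
def NG : Scheme.{u} := Spec (.of (UnitaryRing G))

/-- The inclusion `N_G → U_G`. -/
def unitaryι : NG G ⟶ UG G := Spec.map (CommRingCat.ofHom (toUnitaryRing G))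

theorem sum_coord : ∑ g : G, coord g = 1 := by
  have h := Ideal.Quotient.eq_zero_iff_mem.mpr (Ideal.mem_span_singleton_self
    (∑ g : G, algebraMap (MvPolynomial G ℤ) (Localization.Away (groupDet G))
      (MvPolynomial.X g) - 1))
  rw [map_sub, map_one, sub_eq_zero, map_sum] at h
  exact h

theorem isUnit_det_coord : IsUnit (Matrix.of fun g h : G => coord (g * h)).det := by
  have h : toUnitRing G (groupDet G) = (Matrix.of fun g h : G => coord (g * h)).det := by
    have := RingHom.map_det (toUnitRing G) (Matrix.of fun g h : G => MvPolynomial.X (g * h))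
    exact this
  rw [← h]
  exact (IsLocalization.Away.algebraMap_isUnit (groupDet G)).map (Ideal.Quotient.mk _)

variable {G}

theorem eval_groupDet {R : Type u} [CommRing R] (a : G → R) :
    MvPolynomial.eval₂Hom (Int.castRingHom R) a (groupDet G) =
      (Matrix.of fun g h : G => a (g * h)).det := by
  rw [groupDet, RingHom.map_det]
  congr 1
  ext g h
  simp

/-- The homomorphism `X_g ↦ a_g` on `A`, for a family `a` with invertible group determinant and
sum one. -/
def UnitRing.lift {R : Type u} [CommRing R] (a : G → R)
    (hdet : IsUnit (Matrix.of fun g h : G => a (g * h)).det) (hsum : ∑ g, a g = 1) :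
    UnitRing G →+* R :=
  Ideal.Quotient.lift _
    (IsLocalization.Away.lift (S := Localization.Away (groupDet G)) (groupDet G)
      (g := MvPolynomial.eval₂Hom (Int.castRingHom R) a) (by rwa [eval_groupDet]))
    (by
      intro x hx
      rw [← RingHom.mem_ker]
      refine (Ideal.span_singleton_le_iff_mem _).mpr ?_ hx
      rw [RingHom.mem_ker, map_sub, map_sum, map_one, sub_eq_zero, ← hsum]
      refine Finset.sum_congr rfl fun g _ => ?_
      rw [IsLocalization.Away.lift_eq]
      simp)

theorem UnitRing.lift_coord {R : Type u} [CommRing R] (a : G → R)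
    (hdet : IsUnit (Matrix.of fun g h : G => a (g * h)).det) (hsum : ∑ g, a g = 1) (g : G) :
    UnitRing.lift a hdet hsum (coord g) = a g := by
  have h : IsUnit (MvPolynomial.eval₂Hom (Int.castRingHom R) a (groupDet G)) := by
    rwa [eval_groupDet]
  change IsLocalization.Away.lift (S := Localization.Away (groupDet G)) (groupDet G) h
    (algebraMap _ _ (MvPolynomial.X g)) = a g
  rw [IsLocalization.Away.lift_eq]
  simp

theorem isUnit_det_coord_mul (k : G) :
    IsUnit (Matrix.of fun g h : G => coord (g * h * k)).det := by
  have h : (Matrix.of fun g h : G => coord (g * h * k)) =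
      (Matrix.of fun g h : G => coord (g * h)).submatrix id (Equiv.mulRight k) := by
    ext g h
    simp [mul_assoc]
  rw [h, Matrix.det_permute']
  exact (((Equiv.Perm.sign (Equiv.mulRight k)).isUnit.map (Int.castRingHom _))).mul
    (isUnit_det_coord G)

/-- The automorphism `X_h ↦ X_{h g⁻¹}` of `A`. -/
def unitRingAct (g : G) : UnitRing G →+* UnitRing G :=
  UnitRing.lift (fun h => coord (h * g⁻¹)) (isUnit_det_coord_mul g⁻¹)
    ((Equiv.sum_comp (Equiv.mulRight g⁻¹) coord).trans (sum_coord G))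

theorem unitRingAct_coord (g h : G) : unitRingAct g (coord h) = coord (h * g⁻¹) :=
  UnitRing.lift_coord ..

/-- The automorphism of `B` induced by `X_h ↦ X_{h g⁻¹}`. -/
def unitaryRingAct (g : G) : UnitaryRing G →+* UnitaryRing G :=
  Ideal.quotientMap _ (unitRingAct g) (by
    rw [Ideal.span_le]
    rintro _ ⟨k, rfl⟩
    refine Ideal.subset_span ⟨k, ?_⟩
    simp only [map_sub, map_sum, map_mul, unitRingAct_coord, mul_assoc, apply_ite (unitRingAct g),
      map_one, map_zero]
    have h := Equiv.sum_comp (Equiv.mulRight g⁻¹) fun h : G => coord (k * h) * coord h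
    exact congrArg (fun z => z - if k = 1 then 1 else 0) h.symm)

/-- Right multiplication by `g` on `U_G`. -/
def unitAct (g : G) : UG G ⟶ UG G := Spec.map (CommRingCat.ofHom (unitRingAct g))

/-- Right multiplication by `g` on `N_G`. -/
def unitaryAct (g : G) : NG G ⟶ NG G := Spec.map (CommRingCat.ofHom (unitaryRingAct g))

variable (G)

/-- The morphism `U_G → P(V)`, `∑ a_g [g] ↦ (a_g)_g`, that is, the inclusion `U_G → V ∖ {0}`
followed by `V ∖ {0} → P(V)`. -/
def unitι : UG G ⟶ PV G :=
  Proj.fromOfGlobalSections (grading G)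
    ((Scheme.ΓSpecIso (.of (UnitRing G))).inv.hom.comp (toUnitRing G)) (by
      rw [Ideal.eq_top_iff_one]
      have h := Ideal.mem_map_of_mem
        ((Scheme.ΓSpecIso (.of (UnitRing G))).inv.hom.comp (toUnitRing G))
        (HomogeneousIdeal.mem_irrelevant_of_mem (grading G) one_pos
          (x := ∑ g : G, MvPolynomial.X g)
          (sum_mem fun g _ => MvPolynomial.isHomogeneous_X ℤ g))
      rw [RingHom.comp_apply, map_sum] at h
      have h' : ∑ g : G, toUnitRing G (MvPolynomial.X g) = 1 := sum_coord G
      rw [h', map_one] at h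
      exact h)

/-- The augmentation `∑ a_g [g] ↦ ∑ a_g`. -/
def augmentation (R : Type u) [CommRing R] : MonoidAlgebra R G →+* R :=
  (MonoidAlgebra.lift R R G (1 : G →* R)).toRingHom

variable {G} in
/-- The involution `∑ a_g [g] ↦ ∑ a_g [g⁻¹]` of the group ring. -/
def bar {R : Type u} [CommRing R] (u : MonoidAlgebra R G) : MonoidAlgebra R G :=
  MonoidAlgebra.mapDomain (fun g => g⁻¹) u

/-- The units of augmentation one of `R[G]`. -/
def augUnits (R : Type u) [CommRing R] : Set (MonoidAlgebra R G) :=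
  {u | IsUnit u ∧ augmentation G R u = 1}

/-- The unitary units of augmentation one of `R[G]`. -/
def unitaryUnits (R : Type u) [CommRing R] : Set (MonoidAlgebra R G) :=
  {u | u ∈ augUnits G R ∧ u * bar u = 1}

variable {G} in
/-- The element `∑ φ(X_g) [g]` of `R[G]` given by an `R`-valued point of `U_G`. -/
def evalUnit {R : Type u} [CommRing R] (φ : UnitRing G →+* R) : MonoidAlgebra R G :=
  ∑ g : G, MonoidAlgebra.single g (φ (coord g))

end Schemes

/-! ### Quotients by finite groups -/

/-- `π : X ⟶ Q` is the quotient of `X` by the group `G` acting through the endomorphisms `ρ g`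
(a quotient by an admissible action): `π` is `G`-invariant, affine, and identifies `𝒪_Q` with the
sheaf of invariants `(π_* 𝒪_X)^G`. Such a `π` is unique up to unique isomorphism. -/
structure IsQuotient {G : Type u} {X Q : Scheme.{u}} (ρ : G → (X ⟶ X)) (π : X ⟶ Q) : Prop where
  comp_eq : ∀ g, ρ g ≫ π = π
  isAffineHom : IsAffineHom π
  injective_app : ∀ V : Q.Opens, Function.Injective (π.app V)
  mem_range_app_iff : ∀ (V : Q.Opens) (s : Γ(X, π ⁻¹ᵁ V)),
    s ∈ Set.range (π.app V) ↔ ∀ g, (ρ g).appLE (π ⁻¹ᵁ V) (π ⁻¹ᵁ V)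
      (by rw [← Scheme.Hom.comp_preimage, comp_eq g]) s = s

/-- The functor of points `R ↦ X(R) = Hom(Spec R, X)` on commutative rings. -/
def points : Scheme.{u} ⥤ CommRingCat.{u} ⥤ Type u :=
  yoneda ⋙ (Functor.whiskeringLeft _ _ _).obj Scheme.Spec.rightOp

end NormalModuli

end

open CategoryTheory AlgebraicGeometry NormalModuli

universe u

noncomputable section

open TensorProduct

namespace NormalModuli

/-! ### A local criterion for quotients -/

section Quotients

open TopologicalSpace Opposite

variable {G : Type u} {X Q : Scheme.{u}} {ρ : G → (X ⟶ X)} {π : X ⟶ Q}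

/-! Three observations carry the theorem.

Units. Up to inverting the column index, `(u_{gh})` is the matrix of multiplication by `u` on
`R[G]`. So `u` is a unit exactly when the group determinant is invertible (`isUnit_iff_isUnit_det`),
and the equations of `N_G` are the coefficients of `u * bar u = 1`.

Quotients. The quotient of `P(V)` is `Proj` of the invariant graded ring. The invariant charts cover
`P(V)` because every form is integral over the invariants (`avoidsBaseLocus_invariantsIncl`), and a
fraction with invariant denominator that is itself invariant has an invariant numerator. Normalizing
the sum of coordinates to one identifies `U_G` with `D₊(f)`, where `f = (∑ X_g) * det ^ 2`. The
square removes the sign by which `G` acts on the determinant, so `f` is invariant and `U_G/G` is the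
chart of `P(V)/G` at `f`. The map `A^G → B^G` is onto because the translates of `X_1` sum to one, a
substitute for dividing by the order of `G`.

Moduli. The pair `(A, X_1)` over `A^G` is universal. The matrix of conjugates of `X_1` is
invertible, and Cramer's rule turns this into a normal basis over the invariants and into the torsor
condition (`exists_basis_of_isUnit_det`, `IsGaloisAlgebra.of_basis`). Given `(S, x)`, the assignment
`X_g ↦ g⁻¹ x` is the only equivariant map `A → S` taking `X_1` to `x`. It restricts to `A^G → R`,
and since it carries a basis to a basis, `(S, x)` is the base change of the universal pair. The
trace of a Galois algebra is the sum of conjugates, so self-duality of `x` says that `A → S` kills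
the equations of `N_G`, that is, that `A^G → R` factors through `B^G`. -/

theorem preimage_le_of_comp_eq (h : ∀ g, ρ g ≫ π = π) (V : Q.Opens) (g : G) :
    π ⁻¹ᵁ V ≤ ρ g ⁻¹ᵁ π ⁻¹ᵁ V := by
  rw [← Scheme.Hom.comp_preimage, h g]

/-- Over `V`, the sections of `𝒪_Q` are the invariant sections of `π_* 𝒪_X`. -/
structure HasInvariantSections (h : ∀ g, ρ g ≫ π = π) (V : Q.Opens) : Prop where
  injective : Function.Injective (π.app V)
  mem_range : ∀ s : Γ(X, π ⁻¹ᵁ V),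
    (∀ g, (ρ g).appLE (π ⁻¹ᵁ V) (π ⁻¹ᵁ V) (preimage_le_of_comp_eq h V g) s = s) →
      s ∈ Set.range (π.app V)

theorem appLE_app_of_comp_eq (h : ∀ g, ρ g ≫ π = π) (V : Q.Opens) (g : G) (t : Γ(Q, V)) :
    (ρ g).appLE (π ⁻¹ᵁ V) (π ⁻¹ᵁ V) (preimage_le_of_comp_eq h V g) (π.app V t) = π.app V t := by
  have : π.app V ≫ (ρ g).appLE (π ⁻¹ᵁ V) (π ⁻¹ᵁ V) (preimage_le_of_comp_eq h V g) = π.app V := by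
    have h' := Scheme.Hom.comp_appLE (ρ g) π V (π ⁻¹ᵁ V) (by rw [h g])
    simp only [h g, Scheme.Hom.appLE_eq_app] at h'
    exact h'.symm
  exact congr($this t)

theorem appLE_map_of_comp_eq (h : ∀ g, ρ g ≫ π = π) {V W : Q.Opens} (i : W ⟶ V) (g : G)
    (s : Γ(X, π ⁻¹ᵁ V)) :
    (ρ g).appLE (π ⁻¹ᵁ W) (π ⁻¹ᵁ W) (preimage_le_of_comp_eq h W g)
        (X.presheaf.map ((Opens.map π.base).map i).op s) =
      X.presheaf.map ((Opens.map π.base).map i).op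
        ((ρ g).appLE (π ⁻¹ᵁ V) (π ⁻¹ᵁ V) (preimage_le_of_comp_eq h V g) s) := by
  have : X.presheaf.map ((Opens.map π.base).map i).op ≫
      (ρ g).appLE (π ⁻¹ᵁ W) (π ⁻¹ᵁ W) (preimage_le_of_comp_eq h W g) =
      (ρ g).appLE (π ⁻¹ᵁ V) (π ⁻¹ᵁ V) (preimage_le_of_comp_eq h V g) ≫
        X.presheaf.map ((Opens.map π.base).map i).op := by
    rw [Scheme.Hom.map_appLE, Scheme.Hom.appLE_map]
  exact congr($this s)

theorem app_map_apply {V W : Q.Opens} (i : W ⟶ V) (t : Γ(Q, V)) :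
    π.app W (Q.presheaf.map i.op t) =
      X.presheaf.map ((Opens.map π.base).map i).op (π.app V t) := by
  have := π.naturality i.op
  exact congr($this t)

/-- Taking invariants commutes with localization at an invariant function because `G` is finite: if
`s` times a power of `f` extends to `a` over `U`, each translate of `a` agrees with `a` after
multiplication by some power of `f`, and one power serves all of `G`. -/
theorem HasInvariantSections.basicOpen [Finite G] {h : ∀ g, ρ g ≫ π = π} {U : Q.Opens}
    (hU : IsAffineOpen U) (hU' : IsAffineOpen (π ⁻¹ᵁ U)) (H : HasInvariantSections h U)
    (f : Γ(Q, U)) : HasInvariantSections h (Q.basicOpen f) := by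
  classical
  have := Fintype.ofFinite G
  let i : Q.basicOpen f ⟶ U := homOfLE (Q.basicOpen_le f)
  let i' : π ⁻¹ᵁ Q.basicOpen f ⟶ π ⁻¹ᵁ U := (Opens.map π.base).map i
  let : Algebra Γ(Q, U) Γ(Q, Q.basicOpen f) := (Q.presheaf.map i.op).hom.toAlgebra
  let : Algebra Γ(X, π ⁻¹ᵁ U) Γ(X, π ⁻¹ᵁ Q.basicOpen f) := (X.presheaf.map i'.op).hom.toAlgebra
  have hl : IsLocalization.Away f Γ(Q, Q.basicOpen f) := hU.isLocalization_of_eq_basicOpen f i rfl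
  have hl' : IsLocalization.Away (π.app U f) Γ(X, π ⁻¹ᵁ Q.basicOpen f) :=
    hU'.isLocalization_of_eq_basicOpen _ i' (Scheme.preimage_basicOpen ..)
  have hn (t : Γ(Q, U)) : π.app (Q.basicOpen f) (algebraMap _ _ t) =
      algebraMap Γ(X, π ⁻¹ᵁ U) Γ(X, π ⁻¹ᵁ Q.basicOpen f) (π.app U t) := app_map_apply i t
  have ha (g : G) (s : Γ(X, π ⁻¹ᵁ U)) : (ρ g).appLE (π ⁻¹ᵁ Q.basicOpen f) (π ⁻¹ᵁ Q.basicOpen f)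
      (preimage_le_of_comp_eq h _ g) (algebraMap _ _ s) =
      algebraMap _ _ ((ρ g).appLE (π ⁻¹ᵁ U) (π ⁻¹ᵁ U) (preimage_le_of_comp_eq h U g) s) :=
    appLE_map_of_comp_eq h i g s
  have hf : IsUnit (algebraMap Γ(Q, U) Γ(Q, Q.basicOpen f) f) :=
    IsLocalization.Away.algebraMap_isUnit f
  refine ⟨?_, fun s hs => ?_⟩
  · refine (injective_iff_map_eq_zero (π.app (Q.basicOpen f)).hom).mpr fun x hx => ?_
    obtain ⟨n, a, hna⟩ := IsLocalization.Away.surj f x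
    have h0 : algebraMap Γ(X, π ⁻¹ᵁ U) Γ(X, π ⁻¹ᵁ Q.basicOpen f) (π.app U a) =
        algebraMap Γ(X, π ⁻¹ᵁ U) _ 0 := by
      rw [← hn, ← hna, map_mul, map_zero]
      exact mul_eq_zero_of_left hx _
    obtain ⟨m, hm⟩ := IsLocalization.Away.exists_of_eq (π.app U f) h0
    have h1 : f ^ m * a = 0 := H.injective (by rw [map_mul, map_pow, hm, mul_zero, map_zero])
    have h2 := congrArg (algebraMap Γ(Q, U) Γ(Q, Q.basicOpen f)) h1
    rw [map_mul, map_pow, map_zero, (hf.pow m).mul_right_eq_zero, ← hna,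
      (hf.pow n).mul_left_eq_zero] at h2
    exact h2
  · obtain ⟨n, a, hna⟩ := IsLocalization.Away.surj (π.app U f) s
    have h0 (g : G) : ∃ m : ℕ, π.app U f ^ m *
        (ρ g).appLE (π ⁻¹ᵁ U) (π ⁻¹ᵁ U) (preimage_le_of_comp_eq h U g) a = π.app U f ^ m * a := by
      refine IsLocalization.Away.exists_of_eq (S := Γ(X, π ⁻¹ᵁ Q.basicOpen f)) (π.app U f) ?_
      rw [← ha, ← hna, map_mul, hs, map_pow, ha, appLE_app_of_comp_eq h]
    choose m hm using h0
    -- The sum is used only as a common upper bound of the exponents.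
    let M := ∑ g, m g
    have hM (g : G) : m g ≤ M := Finset.single_le_sum (fun _ _ => Nat.zero_le _) (Finset.mem_univ g)
    obtain ⟨r, hr⟩ := H.mem_range (π.app U f ^ M * a) fun g => by
      rw [map_mul, map_pow, appLE_app_of_comp_eq, ← Nat.sub_add_cancel (hM g), pow_add, mul_assoc,
        hm, mul_assoc]
      exact h
    obtain ⟨v, hv⟩ := hf
    refine ⟨algebraMap _ _ r * ((v⁻¹ : _ˣ) : Γ(Q, Q.basicOpen f)) ^ (n + M), ?_⟩
    have hu := ((IsLocalization.Away.algebraMap_isUnit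
      (S := Γ(X, π ⁻¹ᵁ Q.basicOpen f)) (π.app U f)).pow (n + M))
    refine hu.mul_left_injective ?_
    have : π.app (Q.basicOpen f) ((v⁻¹ : _ˣ) : Γ(Q, Q.basicOpen f)) *
        algebraMap Γ(X, π ⁻¹ᵁ U) Γ(X, π ⁻¹ᵁ Q.basicOpen f) (π.app U f) = 1 := by
      rw [← hn, ← hv, ← map_mul, Units.inv_mul, map_one]
    change π.app (Q.basicOpen f) _ * _ = _
    rw [map_mul, map_pow, mul_assoc, ← mul_pow, this, one_pow, mul_one, hn, hr, map_mul,
      map_pow, ← hna]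
    ring

/-- A `G`-invariant morphism is a quotient if it is one over the members of an affine open cover
with affine preimages. -/
theorem IsQuotient.of_isAffineOpen [Finite G] (h : ∀ g, ρ g ≫ π = π) {ι : Type*}
    (W : ι → Q.Opens) (hW : ⨆ i, W i = ⊤) (hA : ∀ i, IsAffineOpen (W i))
    (hA' : ∀ i, IsAffineOpen (π ⁻¹ᵁ W i)) (H : ∀ i, HasInvariantSections h (W i)) :
    IsQuotient ρ π := by
  have hx (x : Q) : ∃ i, x ∈ W i := Opens.mem_iSup.mp (hW ▸ Opens.mem_top x)
  have key (V : Q.Opens) (x : V) : ∃ U : Q.Opens, x.1 ∈ U ∧ U ≤ V ∧ HasInvariantSections h U := by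
    obtain ⟨i, hi⟩ := hx x
    obtain ⟨f, hf, hf'⟩ := (hA i).exists_basicOpen_le x hi
    exact ⟨_, hf', hf, (H i).basicOpen (hA i) (hA' i) f⟩
  have inj (V : Q.Opens) : Function.Injective (π.app V) := by
    choose U hU hUV HU using key V
    intro s t hst
    refine Q.sheaf.eq_of_locally_eq' U V (fun x => homOfLE (hUV x))
      (fun x hx => Opens.mem_iSup.mpr ⟨⟨x, hx⟩, hU _⟩) s t fun x => (HU x).injective ?_
    exact (app_map_apply _ _).trans ((congrArg _ hst).trans (app_map_apply _ _).symm)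
  refine ⟨h, isAffineHom_of_forall_exists_isAffineOpen _ fun x => ?_, inj,
    fun V s => ⟨?_, fun hs => ?_⟩⟩
  · obtain ⟨i, hi⟩ := hx x
    exact ⟨W i, hi, hA i, hA' i⟩
  · rintro ⟨t, rfl⟩ g
    exact appLE_app_of_comp_eq h V g t
  · choose U hU hUV HU using key V
    have hr (x : V) : ∃ t, π.app (U x) t =
        X.presheaf.map ((Opens.map π.base).map (homOfLE (hUV x))).op s :=
      (HU x).mem_range _ fun g => by rw [appLE_map_of_comp_eq h, hs]
    choose t ht using hr
    have hc : V ≤ iSup U := fun x hx => Opens.mem_iSup.mpr ⟨⟨x, hx⟩, hU _⟩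
    -- The local preimages glue: injectivity is already known over every open set, in particular
    -- over the overlaps, where both images are restrictions of `s`.
    obtain ⟨t', ht', -⟩ := Q.sheaf.existsUnique_gluing' U V (fun x => homOfLE (hUV x))
      hc t fun x y => by
        apply inj
        refine (app_map_apply (homOfLE inf_le_left) _).trans
          (.trans ?_ (app_map_apply (homOfLE inf_le_right) _).symm)
        rw [ht, ht, ← ConcreteCategory.comp_apply, ← ConcreteCategory.comp_apply,
          ← X.presheaf.map_comp, ← X.presheaf.map_comp]
        rfl
    refine ⟨t', ?_⟩
    refine X.sheaf.eq_of_locally_eq' (fun x => π ⁻¹ᵁ U x) (π ⁻¹ᵁ V)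
      (fun x => (Opens.map π.base).map (homOfLE (hUV x)))
      (fun x hx => Opens.mem_iSup.mpr ⟨⟨π.base x, hx⟩, hU _⟩) _ _ fun x => ?_
    refine (app_map_apply _ _).symm.trans ((congrArg _ (ht' x)).trans (ht x))

/-- Identifies the sections over the range of a chart with the global sections of its source. The
range enters through an equation because a chart of `X` has range `π ⁻¹ᵁ W` only propositionally. -/
theorem isIso_appLE_top {Y Z : Scheme.{u}} (f : Y ⟶ Z) [IsOpenImmersion f] {V : Z.Opens}
    (hV : f.opensRange = V) (e : ⊤ ≤ f ⁻¹ᵁ V) : IsIso (f.appLE V ⊤ e) := by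
  subst hV
  have := f.isIso_app f.opensRange le_rfl
  have : homOfLE e = eqToHom (top_le_iff.mp e).symm := rfl
  rw [Scheme.Hom.appLE, this]
  infer_instance

theorem le_preimage_of_opensRange_eq {Y Z : Scheme.{u}} {f : Y ⟶ Z} [IsOpenImmersion f]
    {V : Z.Opens} (hV : f.opensRange = V) : ⊤ ≤ f ⁻¹ᵁ V := by
  subst hV
  simp

/-- Translates a commutative square of charts into one of rings of sections. Keeping `f` as a
variable lets it serve both for the chart of `π` and for the charts of the maps `ρ g`. -/
theorem specMap_comp_appLE_top {R S : CommRingCat.{u}} (φ : R ⟶ S) (a : Spec R ⟶ Q) {W : Q.Opens}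
    (e : ⊤ ≤ a ⁻¹ᵁ W) (f : Spec S ⟶ Q) (hf : f = Spec.map φ ≫ a) (e' : ⊤ ≤ f ⁻¹ᵁ W) :
    f.appLE W ⊤ e' ≫ (Scheme.ΓSpecIso S).hom =
      (a.appLE W ⊤ e ≫ (Scheme.ΓSpecIso R).hom) ≫ φ := by
  subst hf
  have := Scheme.Hom.appLE_comp_appLE (Spec.map φ) a W ⊤ ⊤ e le_rfl
  rw [← this, Category.assoc, Category.assoc, ← Scheme.ΓSpecIso_naturality]
  congr 1

/-- A `G`-invariant morphism is a quotient if, in affine charts, it is given by the inclusion of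
rings of invariants. -/
theorem IsQuotient.of_charts [Finite G] (h : ∀ g, ρ g ≫ π = π) {ι : Type*}
    {R S : ι → CommRingCat.{u}} (a : ∀ i, Spec (R i) ⟶ Q) (b : ∀ i, Spec (S i) ⟶ X)
    [∀ i, IsOpenImmersion (a i)] [∀ i, IsOpenImmersion (b i)] (φ : ∀ i, R i ⟶ S i)
    (σ : ∀ i, G → (S i ⟶ S i)) (hcov : ⨆ i, (a i).opensRange = ⊤)
    (hrange : ∀ i, (b i).opensRange = π ⁻¹ᵁ (a i).opensRange)
    (hsq : ∀ i, b i ≫ π = Spec.map (φ i) ≫ a i)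
    (hσ : ∀ i g, b i ≫ ρ g = Spec.map (σ i g) ≫ b i)
    (hinj : ∀ i, Function.Injective (φ i))
    (hmem : ∀ i s, (∀ g, σ i g s = s) → s ∈ Set.range (φ i)) : IsQuotient ρ π := by
  refine IsQuotient.of_isAffineOpen h (fun i => (a i).opensRange) hcov
    (fun i => isAffineOpen_opensRange _) (fun i => hrange i ▸ isAffineOpen_opensRange _)
    fun i => ?_
  let W := (a i).opensRange
  have ea : ⊤ ≤ a i ⁻¹ᵁ W := le_preimage_of_opensRange_eq rfl
  have eb : ⊤ ≤ b i ⁻¹ᵁ π ⁻¹ᵁ W := le_preimage_of_opensRange_eq (hrange i)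
  have := isIso_appLE_top (a i) rfl ea
  have := isIso_appLE_top (b i) (hrange i) eb
  let α := (a i).appLE W ⊤ ea ≫ (Scheme.ΓSpecIso (R i)).hom
  let β := (b i).appLE (π ⁻¹ᵁ W) ⊤ eb ≫ (Scheme.ΓSpecIso (S i)).hom
  have hα : Function.Bijective α := ConcreteCategory.bijective_of_isIso α
  have hβ : Function.Bijective β := ConcreteCategory.bijective_of_isIso β
  have h₁ : π.app W ≫ β = α ≫ φ i :=
    (Category.assoc _ _ _).symm.trans ((congrArg (· ≫ (Scheme.ΓSpecIso (S i)).hom)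
      (Scheme.Hom.comp_appLE (b i) π W ⊤ eb).symm).trans
        (specMap_comp_appLE_top (φ i) (a i) ea _ (hsq i) eb))
  have h₂ (g : G) : (ρ g).appLE (π ⁻¹ᵁ W) (π ⁻¹ᵁ W) (preimage_le_of_comp_eq h W g) ≫ β =
      β ≫ σ i g := by
    rw [← specMap_comp_appLE_top (σ i g) (b i) eb _ (hσ i g)
      (eb.trans ((b i).preimage_mono (preimage_le_of_comp_eq h W g))),
      ← Scheme.Hom.appLE_comp_appLE _ _ _ _ _ (preimage_le_of_comp_eq h W g) eb, Category.assoc]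
  refine ⟨fun s t hst => hα.1 (hinj i ?_), fun s hs => ?_⟩
  · exact (congr($h₁ s).symm.trans (congrArg β hst)).trans congr($h₁ t)
  · obtain ⟨r, hr⟩ := hmem i (β s) fun g => by
      have := congr($(h₂ g) s)
      exact this.symm.trans (congrArg β (hs g))
    obtain ⟨t, rfl⟩ := hα.2 r
    exact ⟨t, hβ.1 (congr($h₁ t).trans hr)⟩

/-- The spectrum of a ring is a quotient of that of an overring in which it is the ring of
invariants. -/
theorem IsQuotient.specMap [Finite G] {R S : CommRingCat.{u}} (φ : R ⟶ S) (σ : G → (S ⟶ S))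
    (hσ : ∀ g, φ ≫ σ g = φ) (hinj : Function.Injective φ)
    (hmem : ∀ s, (∀ g, σ g s = s) → s ∈ Set.range φ) :
    IsQuotient (fun g => Spec.map (σ g)) (Spec.map φ) :=
  IsQuotient.of_charts (ι := Unit) (fun g => by rw [← Spec.map_comp, hσ]) (R := fun _ => R)
    (S := fun _ => S) (fun _ => 𝟙 _) (fun _ => 𝟙 _) (fun _ => φ) (fun _ => σ)
    (by simp [Scheme.Hom.opensRange_of_isIso]) (by simp [Scheme.Hom.opensRange_of_isIso])
    (by simp) (by simp) (fun _ => hinj) (fun _ => hmem)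

end Quotients

/-! ### Morphisms between projective spectra -/

section ProjMap

open HomogeneousLocalization Proj Limits Graded

variable {A B σ τ : Type u} [CommRing A] [SetLike σ A] [AddSubgroupClass σ A]
  [CommRing B] [SetLike τ B] [AddSubgroupClass τ B]
  {𝒜 : ℕ → σ} {ℬ : ℕ → τ} [GradedRing 𝒜] [GradedRing ℬ]

/-- The homogeneous elements of positive degree. -/
abbrev PosHomogeneous (𝒜 : ℕ → σ) : Type u := Σ' (s : A) (n : ℕ), 0 < n ∧ s ∈ 𝒜 n

/-- The condition for a graded ring homomorphism to induce an everywhere defined morphism of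
projective spectra. -/
def AvoidsBaseLocus (f : GradedRingHom 𝒜 ℬ) : Prop :=
  ∀ x : Proj ℬ, ∃ s : PosHomogeneous 𝒜, x ∈ basicOpen ℬ (f s.1)

/-- The affine open cover of `Proj ℬ` by the `D₊(f(s))`. -/
def mapCover {f : GradedRingHom 𝒜 ℬ} (hf : AvoidsBaseLocus f) : (Proj ℬ).AffineOpenCover where
  I₀ := PosHomogeneous 𝒜
  X s := .of (Away ℬ (f s.1))
  f s := awayι ℬ (f s.1) (map_mem f s.2.2.2) s.2.2.1
  idx x := (hf x).choose
  covers x := by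
    change x ∈ (awayι ℬ _ _ _).opensRange
    rw [opensRange_awayι]
    exact (hf x).choose_spec

theorem awayMap_comp_map (f : GradedRingHom 𝒜 ℬ) {s t : A} {n m : ℕ} (hs : s ∈ 𝒜 n)
    (ht : t ∈ 𝒜 m) :
    (Away.map f (s * t)).comp (awayMap 𝒜 ht rfl) =
      (awayMap ℬ (map_mem f ht) (map_mul f s t)).comp (Away.map f s) := by
  ext y
  obtain ⟨k, a, ha, rfl⟩ := Away.mk_surjective _ hs y
  rw [RingHom.comp_apply, RingHom.comp_apply, awayMap_mk, Away.map_mk, Away.map_mk, awayMap_mk]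
  simp only [Away.val_mk, map_mul, map_pow]

/-- The overlap of the charts at `f s` and `f t` is the spectrum of the degree zero localization at
`f (s * t)`; both composites restrict there to the map that `f` induces on the chart at `s * t`. -/
theorem specMap_awayι_compat (f : GradedRingHom 𝒜 ℬ) (s t : PosHomogeneous 𝒜) :
    pullback.fst (awayι ℬ (f s.1) (map_mem f s.2.2.2) s.2.2.1)
        (awayι ℬ (f t.1) (map_mem f t.2.2.2) t.2.2.1) ≫
        Spec.map (CommRingCat.ofHom (Away.map f s.1)) ≫ awayι 𝒜 s.1 s.2.2.2 s.2.2.1 =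
      pullback.snd _ _ ≫
        Spec.map (CommRingCat.ofHom (Away.map f t.1)) ≫ awayι 𝒜 t.1 t.2.2.2 t.2.2.1 := by
  obtain ⟨s, n, hn, hs⟩ := s
  obtain ⟨t, m, hm, ht⟩ := t
  -- The product appears as a variable `x` with an equation so that the two factors can exchange
  -- roles while the chart at `s * t` stays the same term.
  have key {s t x : A} {n m d : ℕ} (hn : 0 < n) (hs : s ∈ 𝒜 n) (ht : t ∈ 𝒜 m) (hd : 0 < d)
      (hxd : x ∈ 𝒜 d) (hx : x = s * t) (hx' : f x = f s * f t) :
      Spec.map (CommRingCat.ofHom (awayMap ℬ (map_mem f ht) hx')) ≫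
        Spec.map (CommRingCat.ofHom (Away.map f s)) ≫ awayι 𝒜 s hs hn =
      Spec.map (CommRingCat.ofHom (Away.map f x)) ≫ awayι 𝒜 x hxd hd := by
    subst hx
    have h : awayι 𝒜 (s * t) hxd hd = _ := (SpecMap_awayMap_awayι 𝒜 hs hn ht rfl).symm
    rw [h, ← Category.assoc, ← Category.assoc]
    simp only [← Spec.map_comp, ← CommRingCat.ofHom_comp]
    rw [awayMap_comp_map f hs]
  rw [← cancel_epi (pullbackAwayιIso ℬ (map_mem f hs) hn (map_mem f ht) hm (map_mul f s t)).inv]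
  refine (pullbackAwayιIso_inv_fst_assoc ..).trans (.trans ?_
    (pullbackAwayιIso_inv_snd_assoc ..).symm)
  exact (key hn hs ht (Nat.add_pos_left hn m) (SetLike.mul_mem_graded hs ht) rfl _).trans
    (key hm ht hs _ _ (mul_comm _ _) _).symm

/-- The morphism of projective spectra given by a graded ring homomorphism. -/
def projMap {f : GradedRingHom 𝒜 ℬ} (hf : AvoidsBaseLocus f) : Proj ℬ ⟶ Proj 𝒜 :=
  (mapCover hf).openCover.glueMorphisms
    (fun s => Spec.map (CommRingCat.ofHom (Away.map f s.1)) ≫ awayι 𝒜 s.1 s.2.2.2 s.2.2.1)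
    fun s t => specMap_awayι_compat f s t

theorem awayι_projMap {f : GradedRingHom 𝒜 ℬ} (hf : AvoidsBaseLocus f) {n : ℕ} (s : A)
    (hs : s ∈ 𝒜 n) (hn : 0 < n) :
    awayι ℬ (f s) (map_mem f hs) hn ≫ projMap hf =
      Spec.map (CommRingCat.ofHom (Away.map f s)) ≫ awayι 𝒜 s hs hn :=
  (mapCover hf).openCover.ι_glueMorphisms _ _ ⟨s, n, hn, hs⟩

theorem projMap_preimage_basicOpen {f : GradedRingHom 𝒜 ℬ} (hf : AvoidsBaseLocus f) {n : ℕ}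
    {s : A} (hs : s ∈ 𝒜 n) (hn : 0 < n) :
    projMap hf ⁻¹ᵁ basicOpen 𝒜 s = basicOpen ℬ (f s) := by
  ext x
  obtain ⟨⟨t, m, hm, ht⟩, y, rfl⟩ := (mapCover hf).openCover.exists_eq x
  have h₁ := awayι_projMap hf t ht hm
  have h₂ := awayι_preimage_basicOpen 𝒜 ht hm hs hn
  have h₃ := awayι_preimage_basicOpen ℬ (map_mem f ht) hm (map_mem f hs) hn
  have h₄ : awayι ℬ (f t) (map_mem f ht) hm ⁻¹ᵁ projMap hf ⁻¹ᵁ basicOpen 𝒜 s =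
      awayι ℬ (f t) (map_mem f ht) hm ⁻¹ᵁ basicOpen ℬ (f s) := by
    rw [← Scheme.Hom.comp_preimage, h₁, Scheme.Hom.comp_preimage, h₂]
    refine Eq.trans ?_ h₃.symm
    change PrimeSpectrum.basicOpen (Away.map f t _) = _
    rw [Away.isLocalizationElem, Away.map_mk]
    simp only [map_pow]
  exact congr(y ∈ $h₄).to_iff

theorem exists_mem_basicOpen (x : Proj 𝒜) : ∃ s : PosHomogeneous 𝒜, x ∈ basicOpen 𝒜 s.1 := by
  have hx := x.not_irrelevant_le
  rw [HomogeneousIdeal.irrelevant_le] at hx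
  push Not at hx
  obtain ⟨d, hd, hx⟩ := hx
  obtain ⟨a, had, hax⟩ := SetLike.not_le_iff_exists.mp hx
  exact ⟨⟨a, d, hd, had⟩, hax⟩

/-- For an invariant `s` the equality `ρ g s = s` is only propositional, so the charts at both
elements are different terms; the equation `f s = t` makes the action expressible as an endomorphism
of one chart. -/
theorem awayι_comp_map_of_eq {f : GradedRingHom 𝒜 ℬ}
    (hf : HomogeneousIdeal.irrelevant ℬ ≤ (HomogeneousIdeal.irrelevant 𝒜).map f)
    {n : ℕ} (hn : 0 < n) {s : A} (hs : s ∈ 𝒜 n) {t : B} (hst : f s = t) (ht : t ∈ ℬ n)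
    (h : Submonoid.powers s ≤ (Submonoid.powers t).comap f) :
    awayι ℬ t ht hn ≫ Proj.map f hf =
      Spec.map (CommRingCat.ofHom (HomogeneousLocalization.map f h)) ≫ awayι 𝒜 s hs hn := by
  subst hst
  exact awayι_comp_map f hf hn s hs

end ProjMap

/-! ### Invariants of a finite group acting on a graded ring, and the quotient of `Proj`. -/

section GradedInvariants

open HomogeneousLocalization Proj Graded

variable {A σ : Type u} [CommRing A] [SetLike σ A] [AddSubgroupClass σ A]
  {𝒜 : ℕ → σ} {G : Type u} (ρ : G → GradedRingHom 𝒜 𝒜)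

/-- The ring of invariants of a family of graded endomorphisms. -/
def gradedInvariants : Subring A where
  carrier := {a | ∀ g, ρ g a = a}
  mul_mem' ha hb g := by rw [map_mul, ha g, hb g]
  one_mem' g := map_one _
  add_mem' ha hb g := by rw [map_add, ha g, hb g]
  zero_mem' g := map_zero _
  neg_mem' ha g := by rw [map_neg, ha g]

/-- The grading of the ring of invariants. -/
def invariantsGrading (n : ℕ) : AddSubgroup (gradedInvariants ρ) :=
  (AddSubgroup.ofClass (𝒜 n)).comap (gradedInvariants ρ).subtype.toAddMonoidHom

/-- The inclusion of the ring of invariants. -/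
def invariantsIncl : GradedRingHom (invariantsGrading ρ) 𝒜 where
  toRingHom := (gradedInvariants ρ).subtype
  map_mem h := h

theorem map_invariantsIncl (g : G) (s : gradedInvariants ρ) :
    ρ g (invariantsIncl ρ s) = invariantsIncl ρ s := s.2 g

variable {ρ} in
theorem powers_le_comap (g : G) (s : gradedInvariants ρ) :
    Submonoid.powers (invariantsIncl ρ s) ≤
      (Submonoid.powers (invariantsIncl ρ s)).comap (ρ g) := by
  rintro _ ⟨n, rfl⟩
  exact ⟨n, by simp [map_invariantsIncl]⟩

variable [GradedRing 𝒜]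

theorem decompose_mem_gradedInvariants {a : A} (ha : a ∈ gradedInvariants ρ) (n : ℕ) :
    (DirectSum.decompose 𝒜 a n : A) ∈ gradedInvariants ρ := fun g => by
  rw [GradedRingHom.map_directSumDecompose, ha g]

/-- The action preserves degrees, so the homogeneous components of an invariant are invariant;
existence and uniqueness of the decomposition are inherited from `A`. -/
theorem invariantsGrading_isInternal : DirectSum.IsInternal (invariantsGrading ρ) := by
  let F : (DirectSum ℕ fun n => invariantsGrading ρ n) →+ DirectSum ℕ fun n => 𝒜 n :=
    DirectSum.map fun n =>
      { toFun := fun x => ⟨x.1.1, x.2⟩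
        map_zero' := rfl
        map_add' := fun _ _ => rfl }
  have hF (z) : DirectSum.coeAddMonoidHom 𝒜 (F z) =
      (DirectSum.coeAddMonoidHom (invariantsGrading ρ) z).1 := by
    induction z using DirectSum.induction_on with
    | zero => simp
    | of n x => simp [F]
    | add x y hx hy => simp only [map_add, hx, hy, Subring.coe_add]
  have hF' : Function.Injective F := (DirectSum.map_injective _).mpr fun n x y h =>
    Subtype.ext (Subtype.ext congr(($h).1))
  refine ⟨fun x y hxy => hF' ?_, fun a => ?_⟩
  · refine (DirectSum.Decomposition.isInternal 𝒜).1 ?_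
    rw [hF, hF, hxy]
  · classical
    refine ⟨∑ i ∈ (DirectSum.decompose 𝒜 a.1).support, DirectSum.of (fun n => invariantsGrading ρ n)
      i ⟨⟨_, decompose_mem_gradedInvariants ρ a.2 i⟩, (DirectSum.decompose 𝒜 a.1 i).2⟩, ?_⟩
    ext
    rw [map_sum, ← Subring.subtype_apply, map_sum]
    simpa using DirectSum.sum_support_decompose 𝒜 a.1

instance : GradedRing (invariantsGrading ρ) where
  one_mem := SetLike.GradedOne.one_mem (A := 𝒜)
  mul_mem _ _ _ _ hi hj := SetLike.GradedMul.mul_mem (A := 𝒜) hi hj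
  toDecomposition := (invariantsGrading_isInternal ρ).chooseDecomposition

/-- The action on the degree zero part of the localization at an invariant. -/
def awayAct (s : gradedInvariants ρ) (g : G) :
    Away 𝒜 (invariantsIncl ρ s) →+* Away 𝒜 (invariantsIncl ρ s) :=
  HomogeneousLocalization.map (ρ g) (powers_le_comap g s)

theorem awayMap_invariantsIncl_injective {n : ℕ} {s : gradedInvariants ρ}
    (hs : s ∈ invariantsGrading ρ n) :
    Function.Injective (Away.map (invariantsIncl ρ) s) := by
  refine (injective_iff_map_eq_zero _).mpr fun y hy => ?_
  obtain ⟨k, a, ha, rfl⟩ := Away.mk_surjective _ hs y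
  rw [Away.map_mk, HomogeneousLocalization.ext_iff_val, Away.val_mk, val_zero,
    Localization.mk_eq_mk', IsLocalization.mk'_eq_zero_iff] at hy
  obtain ⟨⟨_, m, rfl⟩, hm⟩ := hy
  rw [HomogeneousLocalization.ext_iff_val, Away.val_mk, val_zero,
    Localization.mk_eq_mk', IsLocalization.mk'_eq_zero_iff]
  exact ⟨⟨_, m, rfl⟩, Subtype.ext hm⟩

/-- An invariant fraction `a / s ^ k` need not have an invariant numerator, but `s ^ M * a` is
invariant once `M` is large enough for all of the finite group, and the fraction equals `s ^ M * a /
s ^ (M + k)`. -/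
theorem mem_range_awayMap_invariantsIncl [Finite G] {n : ℕ} {s : gradedInvariants ρ}
    (hs : s ∈ invariantsGrading ρ n) (y : Away 𝒜 (invariantsIncl ρ s))
    (hy : ∀ g, awayAct ρ s g y = y) : y ∈ Set.range (Away.map (invariantsIncl ρ) s) := by
  have := Fintype.ofFinite G
  have hs' : invariantsIncl ρ s ∈ 𝒜 n := hs
  obtain ⟨k, a, ha, rfl⟩ := Away.mk_surjective _ hs' y
  have h0 (g : G) : ∃ m : ℕ, invariantsIncl ρ s ^ m * ρ g a = invariantsIncl ρ s ^ m * a := by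
    have h := congrArg HomogeneousLocalization.val (hy g)
    rw [awayAct, Away.mk, HomogeneousLocalization.map_mk] at h
    simp only [val_mk, map_pow, map_invariantsIncl] at h
    rw [Localization.mk_eq_mk_iff, Localization.r_iff_exists] at h
    obtain ⟨⟨_, m, rfl⟩, hm⟩ := h
    -- Equality of fractions gives cancellation after `s ^ m`, and the cross-multiplied denominators
    -- contribute the further factor `s ^ k`.
    refine ⟨m + k, ?_⟩
    simpa [pow_add, mul_assoc] using hm
  choose m hm using h0
  let M := ∑ g, m g
  have hM (g : G) : m g ≤ M := Finset.single_le_sum (fun _ _ => Nat.zero_le _) (Finset.mem_univ g)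
  let a' : gradedInvariants ρ := ⟨invariantsIncl ρ s ^ M * a, fun g => by
    rw [map_mul, map_pow, map_invariantsIncl, ← Nat.sub_add_cancel (hM g), pow_add, mul_assoc,
      hm, mul_assoc]⟩
  have ha' : a' ∈ invariantsGrading ρ ((M + k) • n) := by
    change invariantsIncl ρ s ^ M * a ∈ 𝒜 ((M + k) • n)
    rw [add_smul]
    exact SetLike.mul_mem_graded (SetLike.pow_mem_graded M hs') ha
  refine ⟨Away.mk _ hs (M + k) a' ha', ?_⟩
  rw [Away.map_mk, HomogeneousLocalization.ext_iff_val, Away.val_mk, Away.val_mk,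
    Localization.mk_eq_mk_iff, Localization.r_iff_exists]
  refine ⟨1, ?_⟩
  change 1 * (invariantsIncl ρ s ^ k * (invariantsIncl ρ s ^ M * a)) =
    1 * (invariantsIncl ρ s ^ (M + k) * a)
  ring

/-- A homogeneous `a` outside the prime `x` is a root of the monic polynomial `∏ (T - ρ g a)`. Its
lower coefficients are invariant, since `G` permutes the conjugates, and homogeneous of positive
degree. If all of them lay in `x`, a power of `a` would, and hence `a` itself. -/
theorem avoidsBaseLocus_invariantsIncl [Group G] [Finite G] (h1 : ∀ a, ρ 1 a = a)
    (hmul : ∀ g h a, ρ g (ρ h a) = ρ (g * h) a) : AvoidsBaseLocus (invariantsIncl ρ) := by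
  classical
  have := Fintype.ofFinite G
  intro x
  obtain ⟨⟨a, d, hd, had⟩, hax⟩ := exists_mem_basicOpen x
  let e (j : ℕ) : A := (Finset.univ.val.map fun g => -ρ g a).esymm j
  have he (j : ℕ) : e j = ∑ t ∈ Finset.powersetCard j Finset.univ, ∏ g ∈ t, -ρ g a :=
    Finset.esymm_map_val ..
  have hinv (j : ℕ) : e j ∈ gradedInvariants ρ := fun k => by
    rw [he, map_sum]
    simp only [map_prod, map_neg, hmul]
    rw [← Finset.esymm_map_val, ← Finset.esymm_map_val]
    congr 1
    exact (Multiset.map_map (fun g => -ρ g a) (fun g => k * g) _).symm.trans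
      (congrArg _ (Multiset.map_univ_val_equiv (Equiv.mulLeft k)))
  have hdeg (j : ℕ) : e j ∈ 𝒜 (j • d) := by
    rw [he]
    refine sum_mem fun t ht => ?_
    rw [← (Finset.mem_powersetCard.mp ht).2, ← Finset.sum_const]
    exact SetLike.prod_mem_graded _ _ _ fun g _ => neg_mem ((ρ g).2 had)
  have hroot := congrArg (Polynomial.eval a)
    (Multiset.prod_X_add_C_eq_sum_esymm (Finset.univ.val.map fun g => -ρ g a))
  rw [Multiset.map_map] at hroot
  by_contra! hc
  have hmem (j : ℕ) (hj : 0 < j) : e j ∈ x.asHomogeneousIdeal := by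
    by_contra h
    exact hc ⟨⟨e j, hinv j⟩, j • d, by positivity, hdeg j⟩ h
  have hzero : (Multiset.map ((fun r => Polynomial.X + Polynomial.C r) ∘ fun g => -ρ g a)
      Finset.univ.val).prod.eval a = 0 := by
    change (∏ g, (Polynomial.X + Polynomial.C (-ρ g a))).eval a = 0
    rw [Polynomial.eval_prod]
    -- The factor of the identity element vanishes at `a`.
    exact Finset.prod_eq_zero (Finset.mem_univ 1) (by simp [h1])
  rw [hzero, Polynomial.eval_finsetSum, Finset.sum_range_succ'] at hroot
  have h0 : (Finset.univ.val.map fun g => -ρ g a).esymm 0 = 1 := by simp [Finset.esymm_map_val]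
  simp only [Polynomial.eval_mul, Polynomial.eval_C, Polynomial.eval_pow, Polynomial.eval_X,
    h0, one_mul] at hroot
  have hpow : a ^ ((Finset.univ.val.map fun g => -ρ g a).card - 0) ∈ x.asHomogeneousIdeal := by
    refine (eq_neg_of_add_eq_zero_right hroot.symm) ▸ ?_
    exact neg_mem (S := Ideal A) (sum_mem fun j _ =>
      Ideal.mul_mem_right _ _ (hmem (j + 1) j.succ_pos))
  exact hax (x.isPrime.mem_of_pow_mem _ hpow)

theorem awayAct_mk {n k : ℕ} {s : gradedInvariants ρ} (hs : invariantsIncl ρ s ∈ 𝒜 n)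
    (g : G) (a : A) (ha : a ∈ 𝒜 (k • n)) :
    awayAct ρ s g (Away.mk 𝒜 hs k a ha) = Away.mk 𝒜 hs k (ρ g a) (map_mem (ρ g) ha) := by
  rw [awayAct, Away.mk, HomogeneousLocalization.map_mk]
  ext
  simp only [val_mk, map_pow, map_invariantsIncl]
  rfl

theorem awayAct_comp_awayMap {n : ℕ} {s : gradedInvariants ρ} (hs : s ∈ invariantsGrading ρ n)
    (g : G) : (awayAct ρ s g).comp (Away.map (invariantsIncl ρ) s) =
      Away.map (invariantsIncl ρ) s := by
  ext y
  obtain ⟨k, a, ha, rfl⟩ := Away.mk_surjective _ hs y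
  rw [RingHom.comp_apply, Away.map_mk, awayAct_mk]
  simp only [Away.val_mk, map_invariantsIncl]

/-- The quotient of `Proj 𝒜` by a finite group of graded automorphisms. -/
theorem isQuotient_projMap [Finite G] (hf : AvoidsBaseLocus (invariantsIncl ρ))
    (hρ : ∀ g, HomogeneousIdeal.irrelevant 𝒜 ≤ (HomogeneousIdeal.irrelevant 𝒜).map (ρ g)) :
    IsQuotient (fun g => Proj.map (ρ g) (hρ g)) (projMap hf) := by
  have hact (s : PosHomogeneous (invariantsGrading ρ)) (g : G) :
      awayι 𝒜 (invariantsIncl ρ s.1) (map_mem _ s.2.2.2) s.2.2.1 ≫ Proj.map (ρ g) (hρ g) =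
        Spec.map (CommRingCat.ofHom (awayAct ρ s.1 g)) ≫
          awayι 𝒜 (invariantsIncl ρ s.1) (map_mem _ s.2.2.2) s.2.2.1 :=
    awayι_comp_map_of_eq (hρ g) s.2.2.1 _ (map_invariantsIncl ρ g s.1) _ _
  have hmap (s : PosHomogeneous (invariantsGrading ρ)) :
      awayι 𝒜 (invariantsIncl ρ s.1) (map_mem _ s.2.2.2) s.2.2.1 ≫ projMap hf =
        Spec.map (CommRingCat.ofHom (Away.map (invariantsIncl ρ) s.1)) ≫
          awayι (invariantsGrading ρ) s.1 s.2.2.2 s.2.2.1 := awayι_projMap hf _ _ _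
  have (s : PosHomogeneous (invariantsGrading ρ)) :
      IsOpenImmersion (awayι 𝒜 (invariantsIncl ρ s.1) (map_mem _ s.2.2.2) s.2.2.1) := inferInstance
  refine IsQuotient.of_charts (fun g => ?_)
    (R := fun s : PosHomogeneous (invariantsGrading ρ) => .of (Away (invariantsGrading ρ) s.1))
    (S := fun s => .of (Away 𝒜 (invariantsIncl ρ s.1)))
    (fun s : PosHomogeneous (invariantsGrading ρ) => awayι _ s.1 s.2.2.2 s.2.2.1)
    (fun s => awayι 𝒜 (invariantsIncl ρ s.1) (map_mem _ s.2.2.2) s.2.2.1)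
    (fun s => CommRingCat.ofHom (Away.map (invariantsIncl ρ) s.1))
    (fun s g => CommRingCat.ofHom (awayAct ρ s.1 g)) ?_ (fun s => ?_) hmap hact
    (fun s => awayMap_invariantsIncl_injective ρ s.2.2.2)
    (fun s y hy => mem_range_awayMap_invariantsIncl ρ s.2.2.2 y hy)
  · refine (mapCover hf).openCover.hom_ext _ _ fun s => ?_
    suffices h : ∀ s : PosHomogeneous (invariantsGrading ρ),
        awayι 𝒜 (invariantsIncl ρ s.1) (map_mem _ s.2.2.2) s.2.2.1 ≫ Proj.map (ρ g) (hρ g) ≫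
          projMap hf = awayι 𝒜 (invariantsIncl ρ s.1) (map_mem _ s.2.2.2) s.2.2.1 ≫ projMap hf from
      h s
    intro s
    rw [← Category.assoc, hact, Category.assoc, hmap, ← Category.assoc, ← Spec.map_comp,
      ← CommRingCat.ofHom_comp, awayAct_comp_awayMap ρ s.2.2.2]
  · refine top_le_iff.mp fun x _ => ?_
    obtain ⟨s, hs⟩ := exists_mem_basicOpen x
    refine TopologicalSpace.Opens.mem_iSup.mpr ⟨s, ?_⟩
    rwa [opensRange_awayι]
  · rw [opensRange_awayι, opensRange_awayι, projMap_preimage_basicOpen hf s.2.2.2 s.2.2.1]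

end GradedInvariants

/-! ### Morphisms to a projective spectrum with a nowhere vanishing coordinate -/

section OfGlobalSections

open HomogeneousLocalization Proj

variable {A σ : Type u} [CommRing A] [SetLike σ A] [AddSubgroupClass σ A]
  {𝒜 : ℕ → σ} [GradedRing 𝒜]

/-- The homomorphism out of the degree zero part of `A_t` given by a homomorphism out of `A` that
inverts `t`. -/
def awayLift {S : Type u} [CommRing S] (F : A →+* S) {t : A} (ht : IsUnit (F t)) :
    Away 𝒜 t →+* S :=
  (IsLocalization.Away.lift (S := Localization.Away t) t ht).comp
    (algebraMap (Away 𝒜 t) (Localization.Away t))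

theorem awayLift_mk_mul {S : Type u} [CommRing S] (F : A →+* S) {t : A} (ht : IsUnit (F t)) {d : ℕ}
    (hd : t ∈ 𝒜 d) (n : ℕ) (a : A) (ha : a ∈ 𝒜 (n • d)) :
    awayLift F ht (Away.mk 𝒜 hd n a ha) * F t ^ n = F a := by
  have h : (Away.mk 𝒜 hd n a ha).val * algebraMap A (Localization.Away t) t ^ n =
      algebraMap A (Localization.Away t) a := by
    rw [Away.val_mk, Localization.mk_eq_mk', ← map_pow]
    exact IsLocalization.mk'_spec (Localization.Away t) a (⟨t ^ n, n, rfl⟩ : Submonoid.powers t)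
  have h' := congrArg (IsLocalization.Away.lift (S := Localization.Away t) t ht) h
  rwa [map_mul, map_pow, IsLocalization.Away.lift_eq, IsLocalization.Away.lift_eq] at h'

/-- The morphism is glued from pieces over the loci where some `F t` is invertible. When `F t` is a
unit, the piece of `t` is all of `X`, so that a single chart describes the whole morphism. -/
theorem fromOfGlobalSections_eq {X : Scheme.{u}} (F : A →+* Γ(X, ⊤))
    (hF : (HomogeneousIdeal.irrelevant 𝒜).toIdeal.map F = ⊤) {t : A} {d : ℕ} (hd : 0 < d)
    (htd : t ∈ 𝒜 d) (ht : IsUnit (F t)) :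
    fromOfGlobalSections 𝒜 F hF =
      X.toSpecΓ ≫ Spec.map (CommRingCat.ofHom (awayLift F ht)) ≫ awayι 𝒜 t htd hd := by
  have htop : X.basicOpen (F t) = ⊤ := X.basicOpen_of_isUnit ht
  have : IsIso (X.basicOpen (F t)).ι :=
    isIso_of_isOpenImmersion_of_opensRange_eq_top _ (by rw [Scheme.Opens.opensRange_ι, htop])
  rw [← cancel_epi (X.basicOpen (F t)).ι]
  refine ((openCoverOfMapIrrelevantEqTop 𝒜 F hF).ι_glueMorphisms _ _ ⟨d, t, hd, htd⟩).trans ?_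
  -- Localizing at a unit changes nothing; `κ` retracts the localization map.
  let κ : Localization.Away (F t) →+* Γ(X, ⊤) :=
    IsLocalization.Away.lift (S := Localization.Away (F t)) (F t) (g := RingHom.id _) ht
  have hκ : κ.comp (algebraMap _ _) = RingHom.id _ := IsLocalization.Away.lift_comp ..
  let ℓ : Localization.Away t →+* Localization.Away (F t) :=
    IsLocalization.map (M := .powers t) (T := .powers (F t)) _ F (by
      rw [← Submonoid.map_le_iff_le_comap, Submonoid.map_powers])
  have hℓ : awayLift (𝒜 := 𝒜) F ht = κ.comp (ℓ.comp (algebraMap _ (Localization.Away t))) := by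
    rw [awayLift, ← RingHom.comp_assoc]
    congr 1
    refine IsLocalization.ringHom_ext (.powers t) ?_
    rw [RingHom.comp_assoc, IsLocalization.map_comp, ← RingHom.comp_assoc, hκ, RingHom.id_comp]
    exact IsLocalization.Away.lift_comp ..
  have hr : (X.isoOfEq (X.toSpecΓ_preimage_basicOpen (F t))).inv ≫ X.toSpecΓ ∣_ _ ≫
      (basicOpenIsoSpecAway _).hom =
      (X.basicOpen (F t)).ι ≫ X.toSpecΓ ≫ Spec.map (CommRingCat.ofHom κ) := by
    have hκ' : Spec.map (CommRingCat.ofHom κ) ≫ Spec.map (CommRingCat.ofHom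
        (algebraMap Γ(X, ⊤) (Localization.Away (F t)))) = 𝟙 _ := by
      rw [← Spec.map_comp, ← CommRingCat.ofHom_comp, hκ]
      exact Spec.map_id _
    rw [← cancel_mono (Spec.map (CommRingCat.ofHom
        (algebraMap Γ(X, ⊤) (Localization.Away (F t))))), Category.assoc, Category.assoc,
        Category.assoc, Category.assoc, hκ', basicOpenIsoSpecAway_hom_SpecMap]
    refine (congrArg (_ ≫ ·) (morphismRestrict_ι _ _)).trans ?_
    rw [Scheme.isoOfEq_inv, Scheme.homOfLE_ι_assoc]
    congr 1
  simp only [toBasicOpenOfGlobalSections, Category.assoc]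
  rw [reassoc_of% hr, hℓ]
  simp only [CommRingCat.ofHom_comp, Spec.map_comp, Category.assoc]
  rfl

theorem comp_awayLift {S T : Type u} [CommRing S] [CommRing T] (φ : S →+* T) (F : A →+* S) {t : A}
    (ht : IsUnit (F t)) :
    φ.comp (awayLift (𝒜 := 𝒜) F ht) = awayLift (φ.comp F) (ht.map φ) := by
  rw [awayLift, awayLift, ← RingHom.comp_assoc]
  congr 1
  refine IsLocalization.ringHom_ext (.powers t) ?_
  ext a
  simp

theorem fromOfGlobalSections_spec {S : Type u} [CommRing S] (F : A →+* S)
    (hF : (HomogeneousIdeal.irrelevant 𝒜).toIdeal.map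
      ((Scheme.ΓSpecIso (.of S)).inv.hom.comp F) = ⊤) {t : A} {d : ℕ} (hd : 0 < d)
    (htd : t ∈ 𝒜 d) (ht : IsUnit (F t)) :
    fromOfGlobalSections 𝒜 ((Scheme.ΓSpecIso (.of S)).inv.hom.comp F) hF =
      Spec.map (CommRingCat.ofHom (awayLift F ht)) ≫ awayι 𝒜 t htd hd := by
  rw [fromOfGlobalSections_eq _ hF hd htd (ht.map (Scheme.ΓSpecIso (.of S)).inv.hom),
    ← comp_awayLift _ F ht, ← SpecMap_ΓSpecIso_hom, ← Category.assoc, ← Spec.map_comp]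
  congr 2
  ext y
  exact congr($((Scheme.ΓSpecIso (.of S)).inv_hom_id) (awayLift F ht y))

theorem isIso_specMap_of_bijective {R S : Type u} [CommRing R] [CommRing S] (f : R →+* S)
    (hf : Function.Bijective f) : IsIso (Spec.map (CommRingCat.ofHom f)) := by
  have : IsIso (CommRingCat.ofHom f) := (ConcreteCategory.isIso_iff_bijective _).mpr hf
  infer_instance

theorem isOpenImmersion_specMap_awayι {S : Type u} [CommRing S] {t : A} {d : ℕ} (htd : t ∈ 𝒜 d)
    (hd : 0 < d) (φ : Away 𝒜 t →+* S) (hφ : Function.Bijective φ) :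
    IsOpenImmersion (Spec.map (CommRingCat.ofHom φ) ≫ awayι 𝒜 t htd hd) := by
  have := isIso_specMap_of_bijective _ hφ
  infer_instance

end OfGlobalSections

/-! ### Invariant rings and the scheme quotients -/

section Invariants

/-- The ring of invariants of a family of endomorphisms. -/
def fixedSubring {ι S : Type*} [CommRing S] (ρ : ι → S →+* S) : Subring S where
  carrier := {a | ∀ g, ρ g a = a}
  mul_mem' ha hb g := by rw [map_mul, ha g, hb g]
  one_mem' g := map_one _
  add_mem' ha hb g := by rw [map_add, ha g, hb g]
  zero_mem' g := map_zero _
  neg_mem' ha g := by rw [map_neg, ha g]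

theorem isQuotient_fixedSubring {G S : Type u} [Finite G] [CommRing S] (ρ : G → S →+* S) :
    IsQuotient (fun g => Spec.map (CommRingCat.ofHom (ρ g)))
      (Spec.map (CommRingCat.ofHom (fixedSubring ρ).subtype)) :=
  IsQuotient.specMap _ _ (fun g => by ext s; exact s.2 g) Subtype.val_injective
    fun s hs => ⟨⟨s, hs⟩, rfl⟩

end Invariants

/-! ### The open immersions of `U_G` into `P(V)` and of `U_G/G` into `P(V)/G`. -/

section Schemes

open HomogeneousLocalization Proj Graded

attribute [local instance] MvPolynomial.gradedAlgebra

variable {G : Type u} [Group G]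

theorem gradedAct_X (g h : G) :
    gradedAct g (MvPolynomial.X h : MvPolynomial G ℤ) = MvPolynomial.X (h * g⁻¹) :=
  MvPolynomial.rename_X ..

theorem gradedAct_one (a : MvPolynomial G ℤ) : gradedAct (1 : G) a = a := by
  change MvPolynomial.rename (fun h : G => h * 1⁻¹) a = a
  simp only [inv_one, mul_one]
  exact MvPolynomial.rename_id_apply a

theorem gradedAct_mul (g h : G) (a : MvPolynomial G ℤ) :
    gradedAct g (gradedAct h a) = gradedAct (g * h) a := by
  change MvPolynomial.rename _ (MvPolynomial.rename _ a) = MvPolynomial.rename _ a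
  rw [MvPolynomial.rename_rename]
  congr 2
  ext k
  simp [mul_assoc]

variable (G) in
theorem avoidsBaseLocus_gradedAct [Finite G] :
    AvoidsBaseLocus (invariantsIncl (gradedAct (G := G))) :=
  avoidsBaseLocus_invariantsIncl _ gradedAct_one gradedAct_mul

variable [Fintype G] [DecidableEq G]

variable (G) in
/-- The sum of the homogeneous coordinates. -/
def coordSum : MvPolynomial G ℤ := ∑ g : G, MvPolynomial.X g

omit [DecidableEq G] in
theorem gradedAct_coordSum (g : G) : gradedAct g (coordSum G) = coordSum G := by
  rw [coordSum, map_sum]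
  simp only [gradedAct_X]
  exact Equiv.sum_comp (Equiv.mulRight g⁻¹) (MvPolynomial.X (R := ℤ))

/-- Right multiplication permutes the columns of the group matrix. The resulting sign is the reason
why `unitForm` contains the square of the determinant. -/
theorem gradedAct_groupDet (g : G) :
    gradedAct g (groupDet G) =
      ((Equiv.Perm.sign (Equiv.mulRight g⁻¹) : ℤ) : MvPolynomial G ℤ) * groupDet G := by
  have h : (gradedAct g).toRingHom.mapMatrix (Matrix.of fun k h : G => MvPolynomial.X (k * h)) =
      (Matrix.of fun k h : G => (MvPolynomial.X (k * h) : MvPolynomial G ℤ)).submatrix id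
        (Equiv.mulRight g⁻¹) := by
    ext1 k h
    refine (gradedAct_X g (k * h)).trans ?_
    simp [mul_assoc]
  refine (RingHom.map_det (gradedAct g).toRingHom _).trans ?_
  rw [h, Matrix.det_permute']
  rfl

theorem isHomogeneous_groupDet : groupDet G ∈ grading G (Fintype.card G) := by
  rw [groupDet, Matrix.det_apply]
  refine sum_mem fun s _ => ?_
  rw [Units.smul_def]
  refine zsmul_mem ?_ _
  have := MvPolynomial.IsHomogeneous.prod Finset.univ
    (fun i => (MvPolynomial.X (s i * i) : MvPolynomial G ℤ)) (fun _ => 1)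
    fun i _ => MvPolynomial.isHomogeneous_X ℤ _
  simpa using this

variable (G) in
/-- The invariant homogeneous form `(∑ X_g) · det (X_{gh})²`, whose non-vanishing locus is the
image of `U_G`. -/
def unitForm : gradedInvariants (gradedAct (G := G)) :=
  ⟨coordSum G * groupDet G ^ 2, fun g => by
    rw [map_mul, map_pow, gradedAct_coordSum, gradedAct_groupDet, mul_pow, ← Int.cast_pow,
      ← Units.val_pow_eq_pow_val, Int.units_sq, Units.val_one, Int.cast_one, one_mul]⟩

theorem invariantsIncl_unitForm :
    invariantsIncl gradedAct (unitForm G) = coordSum G * groupDet G ^ 2 := rfl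

theorem unitForm_mem :
    unitForm G ∈ invariantsGrading (gradedAct (G := G)) (1 + 2 * Fintype.card G) := by
  refine SetLike.mul_mem_graded (A := grading G) ?_ ?_
  · exact sum_mem fun g _ => MvPolynomial.isHomogeneous_X ℤ g
  · exact SetLike.pow_mem_graded 2 isHomogeneous_groupDet

omit [Group G] [DecidableEq G] in
theorem unitForm_pos : 0 < 1 + 2 * Fintype.card G := by omega

theorem toUnitRing_coordSum : toUnitRing G (coordSum G) = 1 := by
  rw [coordSum, map_sum]
  exact sum_coord G

theorem isUnit_toUnitRing_groupDet : IsUnit (toUnitRing G (groupDet G)) :=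
  (IsLocalization.Away.algebraMap_isUnit (groupDet G)).map (Ideal.Quotient.mk _)

theorem toUnitRing_unitForm :
    toUnitRing G (invariantsIncl gradedAct (unitForm G)) = toUnitRing G (groupDet G) ^ 2 := by
  rw [invariantsIncl_unitForm, map_mul, toUnitRing_coordSum, one_mul, map_pow]

theorem isUnit_toUnitRing_unitForm :
    IsUnit (toUnitRing G (invariantsIncl gradedAct (unitForm G))) := by
  rw [toUnitRing_unitForm]
  exact isUnit_toUnitRing_groupDet.pow 2

variable (G) in
/-- The isomorphism of the degree zero part of `ℤ[X_g]_f` with the coordinate ring of `U_G`, where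
`f` is the invariant form. -/
def awayToUnitRing :
    Away (grading G) (invariantsIncl (gradedAct (G := G)) (unitForm G)) →+* UnitRing G :=
  awayLift (toUnitRing G) isUnit_toUnitRing_unitForm

/-- The invariant form becomes a unit in `A`, so `unitι` lands in its chart; the open immersion
property reduces to the bijectivity of `awayToUnitRing`. -/
theorem unitι_eq : unitι G = Spec.map (CommRingCat.ofHom (awayToUnitRing G)) ≫
    awayι (grading G) _ (map_mem (invariantsIncl gradedAct) unitForm_mem) unitForm_pos :=
  fromOfGlobalSections_spec (𝒜 := grading G) (toUnitRing G) _ unitForm_pos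
    (map_mem (invariantsIncl gradedAct) unitForm_mem) isUnit_toUnitRing_unitForm

theorem eval₂_mul_left_of_isHomogeneous {σ R S : Type*} [Fintype σ] [CommSemiring R]
    [CommSemiring S] {p : MvPolynomial σ R} {n : ℕ} (hp : p.IsHomogeneous n) (f : R →+* S)
    (c : S) (x : σ → S) :
    p.eval₂ f (fun i => c * x i) = c ^ n * p.eval₂ f x := by
  rw [MvPolynomial.eval₂_eq', MvPolynomial.eval₂_eq', Finset.mul_sum]
  refine Finset.sum_congr rfl fun d hd => ?_
  simp only [mul_pow, Finset.prod_mul_distrib, Finset.prod_pow_eq_pow_sum]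
  have : ∑ i, d i = n := by
    rw [hp.degree_eq_sum_deg_support hd]
    exact (Finset.sum_subset (Finset.subset_univ _) (by simp)).symm
  rw [this]
  ring

/-- Over the full localization `L` at `f`, the normalized coordinates `X_g / ∑ X_h` form a point of
`U_G`. The resulting map `A → L` sends the image of a form `p` of degree `n` to `p / (∑ X_h) ^ n`,
so a form that vanishes in `A` vanishes in `L`. -/
theorem awayToUnitRing_injective : Function.Injective (awayToUnitRing G) := by
  let f := invariantsIncl gradedAct (unitForm G)
  let L := Localization.Away f
  let α : MvPolynomial G ℤ →+* L := algebraMap _ _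
  have hf : IsUnit (α f) := IsLocalization.Away.algebraMap_isUnit f
  have hf' : α f = α (coordSum G) * α (groupDet G) ^ 2 := by rw [← map_pow, ← map_mul]; rfl
  -- Both factors of `f` are invertible in `L`: the sum can be divided out, and the determinant
  -- remains a unit.
  rw [hf', IsUnit.mul_iff, isUnit_pow_iff two_ne_zero] at hf
  obtain ⟨⟨c, hc⟩, hD⟩ := hf
  let a (g : G) : L := (c⁻¹ : Lˣ) * α (MvPolynomial.X g)
  have ha (p : MvPolynomial G ℤ) {n : ℕ} (hp : p.IsHomogeneous n) :
      MvPolynomial.eval₂Hom (Int.castRingHom L) a p = (c⁻¹ : Lˣ) ^ n * α p := by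
    refine (eval₂_mul_left_of_isHomogeneous hp _ _ _).trans ?_
    congr 1
    change MvPolynomial.eval₂Hom _ _ p = _
    congr 1
    refine MvPolynomial.ringHom_ext' (RingHom.ext_int _ _) fun g => ?_
    simp
  have hdet : IsUnit (Matrix.of fun g h : G => a (g * h)).det := by
    rw [← eval_groupDet, ha _ isHomogeneous_groupDet]
    exact ((c⁻¹).isUnit.pow _).mul hD
  have hsum : ∑ g, a g = 1 := by
    rw [← Finset.mul_sum, ← map_sum]
    change _ * α (coordSum G) = 1
    rw [← hc, Units.inv_mul]
  let ψ := UnitRing.lift a hdet hsum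
  have hψ : ψ.comp (toUnitRing G) = MvPolynomial.eval₂Hom (Int.castRingHom L) a := by
    refine MvPolynomial.ringHom_ext' (RingHom.ext_int _ _) fun g => ?_
    refine (UnitRing.lift_coord a hdet hsum g).trans ?_
    simp
  refine (injective_iff_map_eq_zero _).mpr fun y hy => ?_
  obtain ⟨n, p, hp, rfl⟩ := Away.mk_surjective _
    (map_mem (invariantsIncl (gradedAct (G := G))) unitForm_mem) y
  have h := awayLift_mk_mul (toUnitRing G) isUnit_toUnitRing_unitForm
    (map_mem (invariantsIncl (gradedAct (G := G))) unitForm_mem) n p hp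
  rw [awayToUnitRing] at hy
  rw [hy, zero_mul] at h
  have h' := congr($hψ p)
  rw [RingHom.comp_apply, ← h, map_zero, ha p hp] at h'
  have h'' : α p = 0 := (((c⁻¹).isUnit.pow _).mul_right_eq_zero).mp h'.symm
  ext
  rw [Away.val_mk, val_zero, Localization.mk_eq_mk', IsLocalization.mk'_eq_zero_iff]
  obtain ⟨m, hm⟩ := (IsLocalization.map_eq_zero_iff (Submonoid.powers f) L p).mp h''
  exact ⟨m, hm⟩

theorem awayToUnitRing_mk_mul {n : ℕ} (a : MvPolynomial G ℤ)
    (ha : a ∈ grading G (n • (1 + 2 * Fintype.card G))) :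
    awayToUnitRing G (Away.mk _ (map_mem (invariantsIncl gradedAct) unitForm_mem) n a ha) *
      (toUnitRing G (groupDet G) ^ 2) ^ n = toUnitRing G a := by
  rw [← toUnitRing_unitForm]
  exact awayLift_mk_mul ..

/-- In `A` the sum of coordinates is one, so powers of it adjust the degree of a numerator without
changing its image. This produces the coordinates and the inverse of the determinant, which generate
`A`. -/
theorem awayToUnitRing_surjective : Function.Surjective (awayToUnitRing G) := by
  have hX (g : G) : coord g ∈ (awayToUnitRing G).range := by
    -- The form `f` maps to the squared determinant, so `X_g * det ^ 2 / f` maps to `X_g`.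
    have hmem : MvPolynomial.X g * groupDet G ^ 2 ∈
        grading G (1 • (1 + 2 * Fintype.card G)) := by
      rw [one_smul]
      exact SetLike.mul_mem_graded (MvPolynomial.isHomogeneous_X ℤ g)
        (SetLike.pow_mem_graded 2 isHomogeneous_groupDet)
    have h := awayToUnitRing_mk_mul _ hmem
    rw [map_mul, map_pow, pow_one] at h
    exact ⟨_, (isUnit_toUnitRing_groupDet.pow 2).mul_right_cancel h⟩
  have hD : ∃ y, awayToUnitRing G y * toUnitRing G (groupDet G) = 1 := by
    -- The exponent raises the degree of `det`, which is `card G`, to the degree `1 + 2 * card G` of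
    -- `f`; the quotient by `f` maps to `det⁻¹`.
    have hmem : coordSum G ^ (Fintype.card G + 1) * groupDet G ∈
        grading G (1 • (1 + 2 * Fintype.card G)) := by
      have hs : coordSum G ∈ grading G 1 :=
        sum_mem fun g _ => MvPolynomial.isHomogeneous_X ℤ g
      have := SetLike.mul_mem_graded (SetLike.pow_mem_graded (Fintype.card G + 1) hs)
        isHomogeneous_groupDet
      convert! this using 2
      simp only [smul_eq_mul]
      ring
    have h := awayToUnitRing_mk_mul _ hmem
    rw [map_mul, map_pow, toUnitRing_coordSum, one_pow, one_mul, pow_one, pow_two, ← mul_assoc] at h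
    exact ⟨_, isUnit_toUnitRing_groupDet.mul_right_cancel (h.trans (one_mul _).symm)⟩
  have hP (p : MvPolynomial G ℤ) : toUnitRing G p ∈ (awayToUnitRing G).range := by
    induction p using MvPolynomial.induction_on with
    | C n =>
      rw [← RingHom.comp_apply, eq_intCast]
      exact intCast_mem _ _
    | add p q hp hq => rw [map_add]; exact add_mem hp hq
    | mul_X p g hp => rw [map_mul]; exact mul_mem hp (hX g)
  obtain ⟨u, hu⟩ := hD
  intro z
  obtain ⟨w, rfl⟩ := Ideal.Quotient.mk_surjective z
  obtain ⟨n, a, h⟩ := IsLocalization.Away.surj (groupDet G) w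
  have h' := congrArg (Ideal.Quotient.mk (Ideal.span {∑ g : G, algebraMap (MvPolynomial G ℤ)
    (Localization.Away (groupDet G)) (MvPolynomial.X g) - 1})) h
  rw [map_mul, map_pow] at h'
  change _ * toUnitRing G (groupDet G) ^ n = toUnitRing G a at h'
  obtain ⟨y, hy⟩ := hP a
  refine ⟨y * u ^ n, ?_⟩
  rw [map_mul, map_pow, hy, ← h', mul_assoc, ← mul_pow, mul_comm (toUnitRing G _), hu, one_pow,
    mul_one]

theorem unitRingAct_toUnitRing (g : G) (a : MvPolynomial G ℤ) :
    unitRingAct g (toUnitRing G a) = toUnitRing G (gradedAct g a) := by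
  have : (unitRingAct g).comp (toUnitRing G) = (toUnitRing G).comp (gradedAct g).toRingHom := by
    refine MvPolynomial.ringHom_ext' (RingHom.ext_int _ _) fun h => ?_
    refine (unitRingAct_coord g h).trans ?_
    exact congrArg (toUnitRing G) (gradedAct_X g h).symm
  exact congr($this a)

theorem unitRingAct_awayToUnitRing (g : G) (y) :
    unitRingAct g (awayToUnitRing G y) =
      awayToUnitRing G (awayAct gradedAct (unitForm G) g y) := by
  obtain ⟨n, p, hp, rfl⟩ := Away.mk_surjective _
    (map_mem (invariantsIncl (gradedAct (G := G))) unitForm_mem) y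
  have h₁ := awayLift_mk_mul (toUnitRing G) isUnit_toUnitRing_unitForm
    (map_mem (invariantsIncl (gradedAct (G := G))) unitForm_mem) n p hp
  have h₂ := awayLift_mk_mul (toUnitRing G) isUnit_toUnitRing_unitForm
    (map_mem (invariantsIncl (gradedAct (G := G))) unitForm_mem) n _ (map_mem (gradedAct g) hp)
  have h₃ := congrArg (unitRingAct g) h₁
  rw [map_mul, map_pow, unitRingAct_toUnitRing, map_invariantsIncl, unitRingAct_toUnitRing,
    ← h₂] at h₃
  rw [awayAct_mk]
  exact (isUnit_toUnitRing_unitForm.pow n).mul_right_cancel h₃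

variable (G) in
/-- The isomorphism of `(ℤ[X_g]^G)_(f)` with the coordinate ring of `U_G/G`. -/
def awayToInvariants : Away (invariantsGrading (gradedAct (G := G))) (unitForm G) →+*
    fixedSubring (unitRingAct (G := G)) :=
  ((awayToUnitRing G).comp (Away.map (invariantsIncl gradedAct) (unitForm G))).codRestrict _
    fun y g => by
      rw [RingHom.comp_apply, unitRingAct_awayToUnitRing, ← RingHom.comp_apply (awayAct _ _ _),
        awayAct_comp_awayMap _ unitForm_mem]

theorem awayToInvariants_bijective : Function.Bijective (awayToInvariants G) := by
  refine ⟨fun x y h => ?_, fun a => ?_⟩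
  · exact awayMap_invariantsIncl_injective _ unitForm_mem
      (awayToUnitRing_injective congr(($h).1))
  · obtain ⟨y, hy⟩ := awayToUnitRing_surjective a.1
    obtain ⟨z, rfl⟩ := mem_range_awayMap_invariantsIncl _ unitForm_mem y fun g =>
      awayToUnitRing_injective (by rw [← unitRingAct_awayToUnitRing, hy, a.2 g])
    exact ⟨z, Subtype.ext hy⟩

theorem isOpenImmersion_unitι : IsOpenImmersion (unitι G) := by
  rw [unitι_eq]
  exact isOpenImmersion_specMap_awayι _ _ _ ⟨awayToUnitRing_injective, awayToUnitRing_surjective⟩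

variable (G) in
/-- The quotient of `P(V)` by `G`. -/
def PVQuotient : Scheme.{u} := Proj (invariantsGrading (gradedAct (G := G)))

variable (G) in
/-- The quotient morphism of `P(V)`. -/
def quotientMapPV : PV G ⟶ PVQuotient G := projMap (avoidsBaseLocus_gradedAct G)

omit [DecidableEq G] in
theorem isQuotient_quotientMapPV : IsQuotient projAct (quotientMapPV G) :=
  isQuotient_projMap _ _ irrelevant_le_map_gradedAct

variable (G) in
/-- The open immersion `U_G/G → P(V)/G`. -/
def unitQuotientι : Spec (.of (fixedSubring (unitRingAct (G := G)))) ⟶ PVQuotient G :=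
  Spec.map (CommRingCat.ofHom (awayToInvariants G)) ≫
    awayι (invariantsGrading gradedAct) (unitForm G) unitForm_mem unitForm_pos

theorem isOpenImmersion_unitQuotientι : IsOpenImmersion (unitQuotientι G) :=
  isOpenImmersion_specMap_awayι _ _ _ awayToInvariants_bijective

theorem specMap_subtype_unitQuotientι :
    Spec.map (CommRingCat.ofHom (fixedSubring (unitRingAct (G := G))).subtype) ≫ unitQuotientι G =
      unitι G ≫ quotientMapPV G := by
  have h : Spec.map (CommRingCat.ofHom (fixedSubring (unitRingAct (G := G))).subtype) ≫
      Spec.map (CommRingCat.ofHom (awayToInvariants G)) =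
      Spec.map (CommRingCat.ofHom (awayToUnitRing G)) ≫
        Spec.map (CommRingCat.ofHom (Away.map (invariantsIncl gradedAct) (unitForm G))) := by
    rw [← Spec.map_comp, ← Spec.map_comp]
    rfl
  rw [unitι_eq]
  refine Eq.trans ?_ (congrArg (Spec.map (CommRingCat.ofHom (awayToUnitRing G)) ≫ ·)
    (awayι_projMap (avoidsBaseLocus_gradedAct G) _ unitForm_mem unitForm_pos).symm)
  exact (Category.assoc _ _ _).symm.trans
    ((congrArg (· ≫ awayι _ _ unitForm_mem unitForm_pos) h).trans (Category.assoc _ _ _))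

end Schemes

/-! ### Units of the group ring -/

section GroupRing

variable {G : Type u} [Group G] [Fintype G] {R : Type u} [CommRing R]

/-- The convolution is indexed so that it reads as a product with the matrix `(u_{kh})`, and so that
`v = bar u` yields the left-hand sides of the equations of `N_G`. -/
theorem coeff_mul_eq_sum (u v : MonoidAlgebra R G) (k : G) :
    (u * v).coeff k = ∑ h, u.coeff (k * h) * v.coeff h⁻¹ := by
  rw [MonoidAlgebra.coeff_mul_apply_right, Finsupp.sum_fintype _ _ fun _ => mul_zero _]
  exact (Equiv.sum_comp (Equiv.inv G) _).symm.trans (by simp)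

omit [Fintype G] in
theorem coeff_one_eq_ite [DecidableEq G] (g : G) :
    (1 : MonoidAlgebra R G).coeff g = if g = 1 then 1 else 0 := by
  rw [MonoidAlgebra.one_def, MonoidAlgebra.coeff_single, Finsupp.single_apply]
  simp only [eq_comm]

omit [Fintype G] in
theorem coeff_bar (u : MonoidAlgebra R G) (g : G) : (bar u).coeff g = u.coeff g⁻¹ := by
  have h := Finsupp.mapDomain_apply inv_injective u.coeff g⁻¹
  rwa [inv_inv] at h

theorem augmentation_eq_sum (u : MonoidAlgebra R G) : augmentation G R u = ∑ g, u.coeff g := by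
  change MonoidAlgebra.lift R R G (1 : G →* R) u = _
  rw [MonoidAlgebra.lift_apply, Finsupp.sum_fintype]
  · simp
  · exact fun _ => zero_smul R _

variable [DecidableEq G]

/-- An inverse of `u` supplies an inverse of the matrix. Conversely, the column of the inverse
matrix at `1` gives a right inverse of `u` and its row at `1` a left inverse; both are needed
because `R[G]` need not be commutative. -/
theorem isUnit_iff_isUnit_det (u : MonoidAlgebra R G) :
    IsUnit u ↔ IsUnit (Matrix.of fun g h : G => u.coeff (g * h)).det := by
  constructor
  · rintro ⟨u, rfl⟩
    refine Matrix.isUnit_det_of_right_inverse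
      (B := Matrix.of fun h k : G => (u⁻¹).1.coeff (h⁻¹ * k⁻¹)) ?_
    ext g k
    have h := congr(($(u.mul_inv)).coeff (g * k⁻¹))
    rw [coeff_mul_eq_sum, coeff_one_eq_ite] at h
    simp only [mul_inv_eq_one] at h
    rw [Matrix.mul_apply, Matrix.one_apply, ← h]
    refine (Equiv.sum_comp (Equiv.mulLeft k⁻¹) _).symm.trans ?_
    simp [mul_assoc]
  · intro hu
    let M := Matrix.of fun g h : G => u.coeff (g * h)
    have h₁ : u * .ofCoeff (Finsupp.equivFunOnFinite.symm fun h => M⁻¹ h⁻¹ 1) = 1 := by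
      ext g
      rw [coeff_mul_eq_sum, coeff_one_eq_ite]
      have h := congr($(Matrix.mul_nonsing_inv M hu) g 1)
      rw [Matrix.mul_apply, Matrix.one_apply] at h
      rw [← h]
      simp [M]
    have h₂ : .ofCoeff (Finsupp.equivFunOnFinite.symm fun h => M⁻¹ 1 h⁻¹) * u = 1 := by
      ext g
      rw [MonoidAlgebra.coeff_mul_apply_left, Finsupp.sum_fintype _ _ fun _ => zero_mul _,
        coeff_one_eq_ite]
      have h := congr($(Matrix.nonsing_inv_mul M hu) 1 g)
      rw [Matrix.mul_apply, Matrix.one_apply] at h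
      simp only [eq_comm (a := g)]
      rw [← h]
      refine (Equiv.sum_comp (Equiv.inv G) _).symm.trans ?_
      simp [M]
    rw [isUnit_iff_exists]
    exact ⟨_, h₁, (left_inv_eq_right_inv h₂ h₁) ▸ h₂⟩

end GroupRing

/-! ### Points of `U_G` and `N_G` with values in a ring. -/

section UnitRing

variable {G : Type u} [Group G] [Fintype G] [DecidableEq G] {R : Type u} [CommRing R]

theorem UnitRing.hom_ext {φ ψ : UnitRing G →+* R} (h : ∀ g, φ (coord g) = ψ (coord g)) :
    φ = ψ := by
  refine Ideal.Quotient.ringHom_ext (IsLocalization.ringHom_ext (.powers (groupDet G)) ?_)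
  exact MvPolynomial.ringHom_ext' (RingHom.ext_int _ _) h

theorem isUnit_det_map_coord (φ : UnitRing G →+* R) :
    IsUnit (Matrix.of fun g h : G => φ (coord (g * h))).det := by
  have := (isUnit_det_coord G).map φ
  rwa [RingHom.map_det] at this

/-- A homomorphism out of `A` that satisfies the equations of `N_G` factors through `B`. -/
def UnitaryRing.lift (φ : UnitRing G →+* R)
    (h : ∀ g : G, ∑ h, φ (coord (g * h)) * φ (coord h) = if g = 1 then 1 else 0) :
    UnitaryRing G →+* R :=
  Ideal.Quotient.lift _ φ (by
    suffices Ideal.span _ ≤ RingHom.ker φ from fun a ha => this ha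
    rw [Ideal.span_le]
    rintro _ ⟨g, rfl⟩
    rw [SetLike.mem_coe, RingHom.mem_ker, map_sub, map_sum, apply_ite φ, map_one, map_zero, ← h g]
    simp)

theorem UnitaryRing.lift_comp (φ : UnitRing G →+* R)
    (h : ∀ g : G, ∑ h, φ (coord (g * h)) * φ (coord h) = if g = 1 then 1 else 0) :
    (UnitaryRing.lift φ h).comp (toUnitaryRing G) = φ :=
  rfl

theorem UnitaryRing.sum_map_coord (φ : UnitaryRing G →+* R) (g : G) :
    ∑ h, φ (toUnitaryRing G (coord (g * h))) * φ (toUnitaryRing G (coord h)) =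
      if g = 1 then 1 else 0 := by
  let ψ : UnitRing G →+* R := φ.comp (toUnitaryRing G)
  have h : ψ (∑ h : G, coord (g * h) * coord h - if g = 1 then 1 else 0) = 0 :=
    (congrArg φ (Ideal.Quotient.eq_zero_iff_mem.mpr (Ideal.subset_span ⟨g, rfl⟩))).trans
      (RingHom.map_zero φ)
  rw [map_sub, sub_eq_zero, apply_ite ψ, map_one, map_zero, map_sum] at h
  simp only [map_mul] at h
  exact h

theorem coeff_evalUnit (φ : UnitRing G →+* R) (g : G) :
    (evalUnit φ).coeff g = φ (coord g) := by
  rw [evalUnit, MonoidAlgebra.coeff_sum, Finsupp.finsetSum_apply]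
  simp [MonoidAlgebra.coeff_single, Finsupp.single_apply]

theorem coeff_evalUnit_mul_bar (φ : UnitRing G →+* R) (g : G) :
    (evalUnit φ * bar (evalUnit φ)).coeff g = ∑ h, φ (coord (g * h)) * φ (coord h) := by
  simp only [coeff_mul_eq_sum, coeff_bar, inv_inv, coeff_evalUnit]

theorem evalUnit_mem_augUnits (φ : UnitRing G →+* R) : evalUnit φ ∈ augUnits G R := by
  refine ⟨?_, ?_⟩
  · simp only [isUnit_iff_isUnit_det, coeff_evalUnit]
    exact isUnit_det_map_coord φ
  · simp only [augmentation_eq_sum, coeff_evalUnit]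
    rw [← map_sum, sum_coord, map_one]

theorem evalUnit_injective :
    Function.Injective fun φ : UnitRing G →+* R => evalUnit φ := fun φ ψ h =>
  UnitRing.hom_ext fun g => by
    rw [← coeff_evalUnit, ← coeff_evalUnit]
    exact congr(($h).coeff g)

theorem exists_evalUnit_eq {u : MonoidAlgebra R G} (hu : u ∈ augUnits G R) :
    ∃ φ : UnitRing G →+* R, evalUnit φ = u := by
  refine ⟨UnitRing.lift u.coeff ((isUnit_iff_isUnit_det u).mp hu.1)
    ((augmentation_eq_sum u).symm.trans hu.2), ?_⟩
  ext g
  rw [coeff_evalUnit, UnitRing.lift_coord]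

variable (G R) in
theorem bijOn_evalUnit :
    Set.BijOn (fun φ : UnitRing G →+* R => evalUnit φ) Set.univ (augUnits G R) :=
  ⟨fun φ _ => evalUnit_mem_augUnits φ, evalUnit_injective.injOn, fun _ hu =>
    let ⟨φ, hφ⟩ := exists_evalUnit_eq hu
    ⟨φ, trivial, hφ⟩⟩

variable (G R) in
theorem bijOn_evalUnit_unitary :
    Set.BijOn (fun φ : UnitaryRing G →+* R => evalUnit (φ.comp (toUnitaryRing G))) Set.univ
      (unitaryUnits G R) := by
  refine ⟨fun φ _ => ⟨evalUnit_mem_augUnits _, ?_⟩, fun φ _ ψ _ h => ?_, fun u hu => ?_⟩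
  · ext g
    rw [coeff_evalUnit_mul_bar, coeff_one_eq_ite]
    exact UnitaryRing.sum_map_coord φ g
  · exact Ideal.Quotient.ringHom_ext (evalUnit_injective h)
  · obtain ⟨φ, rfl⟩ := exists_evalUnit_eq hu.1
    refine ⟨UnitaryRing.lift φ fun g => ?_, trivial, ?_⟩
    · rw [← coeff_evalUnit_mul_bar, hu.2, coeff_one_eq_ite]
    · exact congrArg evalUnit (UnitaryRing.lift_comp φ _)

/-! ### The closed immersion of the quotients -/

theorem unitRingAct_one (a : UnitRing G) : unitRingAct 1 a = a := by
  have : unitRingAct (1 : G) = RingHom.id _ := UnitRing.hom_ext fun g => by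
    rw [unitRingAct_coord, inv_one, mul_one, RingHom.id_apply]
  exact congr($this a)

theorem unitRingAct_mul (g h : G) (a : UnitRing G) :
    unitRingAct (g * h) a = unitRingAct g (unitRingAct h a) := by
  have : unitRingAct (g * h) = (unitRingAct g).comp (unitRingAct h) := UnitRing.hom_ext fun k => by
    rw [RingHom.comp_apply, unitRingAct_coord, unitRingAct_coord, unitRingAct_coord, mul_inv_rev,
      mul_assoc]
  exact congr($this a)

theorem toUnitaryRing_unitRingAct (g : G) (a : UnitRing G) :
    toUnitaryRing G (unitRingAct g a) = unitaryRingAct g (toUnitaryRing G a) :=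
  rfl

end UnitRing

section FixedSubringMap

variable {G A B : Type u} [CommRing A] [CommRing B] {ρ : G → A →+* A} {ρ' : G → B →+* B}

/-- The homomorphism of rings of invariants given by an equivariant homomorphism. -/
def fixedSubringMap (f : A →+* B) (hf : ∀ g a, f (ρ g a) = ρ' g (f a)) :
    fixedSubring ρ →+* fixedSubring ρ' :=
  (f.comp (fixedSubring ρ).subtype).codRestrict _ fun a g =>
    (hf g a.1).symm.trans (congrArg f (a.2 g))

/-- A surjective equivariant homomorphism is surjective on invariants if some element of the source
has translates that sum to one. -/
theorem fixedSubringMap_surjective [Group G] [Fintype G] (f : A →+* B)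
    (hf : ∀ g a, f (ρ g a) = ρ' g (f a)) (hsurj : Function.Surjective f)
    (hρ : ∀ g h a, ρ (g * h) a = ρ g (ρ h a)) (c : A) (hc : ∑ g, ρ g c = 1) :
    Function.Surjective (fixedSubringMap f hf) := by
  intro b
  obtain ⟨a, ha⟩ := hsurj b.1
  -- The lift is the sum of the translates of `a * c`: as `b` is invariant, its image is `b` times
  -- the sum of the translates of `c`, which is one.
  refine ⟨⟨∑ k : G, ρ k (a * c), fun g => ?_⟩, Subtype.ext ?_⟩
  · rw [map_sum]
    simp only [← hρ]
    exact Equiv.sum_comp (Equiv.mulLeft g) fun k => ρ k (a * c)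
  · change f (∑ k : G, ρ k (a * c)) = b.1
    have hk (k : G) : f (ρ k (a * c)) = b.1 * f (ρ k c) := by
      rw [map_mul, map_mul, hf, ha, b.2 k]
    rw [map_sum, Finset.sum_congr rfl fun k _ => hk k, ← Finset.mul_sum, ← map_sum, hc, map_one,
      mul_one]

theorem specMap_subtype_fixedSubringMap (f : A →+* B) (hf : ∀ g a, f (ρ g a) = ρ' g (f a)) :
    Spec.map (CommRingCat.ofHom (fixedSubring ρ').subtype) ≫
      Spec.map (CommRingCat.ofHom (fixedSubringMap f hf)) =
      Spec.map (CommRingCat.ofHom f) ≫ Spec.map (CommRingCat.ofHom (fixedSubring ρ).subtype) := by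
  rw [← Spec.map_comp, ← Spec.map_comp]
  rfl

theorem map_fixedSubringMap_eq_zero (f : A →+* B) (hf : ∀ g a, f (ρ g a) = ρ' g (f a))
    {R : Type*} [CommRing R] (θ : fixedSubring ρ' →+* R) {a : fixedSubring ρ} (ha : f a.1 = 0) :
    θ (fixedSubringMap f hf a) = 0 :=
  (congrArg θ (Subtype.ext ha)).trans (map_zero θ)

theorem exists_comp_fixedSubringMap_eq (f : A →+* B) (hf : ∀ g a, f (ρ g a) = ρ' g (f a))
    (hsurj : Function.Surjective (fixedSubringMap f hf)) {R : Type*} [CommRing R]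
    (ψ : fixedSubring ρ →+* R) (hψ : ∀ a, f a.1 = 0 → ψ a = 0) :
    ∃ θ : fixedSubring ρ' →+* R, θ.comp (fixedSubringMap f hf) = ψ :=
  ⟨(fixedSubringMap f hf).liftOfRightInverse _ (Function.rightInverse_surjInv hsurj)
    ⟨ψ, fun a ha => hψ a (congrArg Subtype.val ha)⟩, RingHom.liftOfRightInverse_comp ..⟩

end FixedSubringMap

section UnitRing

variable {G : Type u} [Group G] [Fintype G] [DecidableEq G] {R : Type u} [CommRing R]

variable (G) in
/-- The ring of functions of `U_G/G`. -/
abbrev UnitInvariants : Type u := fixedSubring (unitRingAct (G := G))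

variable (G) in
/-- The ring of functions of `N_G/G`. -/
abbrev UnitaryInvariants : Type u := fixedSubring (S := UnitaryRing G) (unitaryRingAct (G := G))

theorem sum_unitRingAct_coord_one : ∑ g : G, unitRingAct g (coord 1) = 1 := by
  simp only [unitRingAct_coord, one_mul]
  exact (Equiv.sum_comp (Equiv.inv G) coord).trans (sum_coord G)

variable (G) in
/-- The homomorphism `A^G → B^G`. -/
def invariantsToUnitary : UnitInvariants G →+* UnitaryInvariants G :=
  fixedSubringMap (toUnitaryRing G) toUnitaryRing_unitRingAct

/-- The translates of `coord 1` are all the coordinates, and these sum to one; the order of `G` need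
not be invertible. -/
theorem invariantsToUnitary_surjective : Function.Surjective (invariantsToUnitary G) :=
  fixedSubringMap_surjective _ _ Ideal.Quotient.mk_surjective unitRingAct_mul (coord 1)
    sum_unitRingAct_coord_one

variable (G) in
/-- The closed immersion `N_G/G → U_G/G`. -/
def unitaryQuotientι : Spec (.of (UnitaryInvariants G)) ⟶ Spec (.of (UnitInvariants G)) :=
  Spec.map (CommRingCat.ofHom (invariantsToUnitary G))

theorem isClosedImmersion_unitaryQuotientι : IsClosedImmersion (unitaryQuotientι G) :=
  IsClosedImmersion.spec_of_surjective _ invariantsToUnitary_surjective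

variable (G) in
/-- The quotient morphism of `U_G`. -/
def quotientMapUG : UG G ⟶ Spec (.of (UnitInvariants G)) :=
  Spec.map (CommRingCat.ofHom (fixedSubring unitRingAct).subtype)

variable (G) in
/-- The quotient morphism of `N_G`. -/
def quotientMapNG : NG G ⟶ Spec (.of (UnitaryInvariants G)) :=
  Spec.map (CommRingCat.ofHom (fixedSubring (S := UnitaryRing G) unitaryRingAct).subtype)

theorem isQuotient_quotientMapUG : IsQuotient unitAct (quotientMapUG G) :=
  isQuotient_fixedSubring unitRingAct

theorem isQuotient_quotientMapNG : IsQuotient unitaryAct (quotientMapNG G) :=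
  isQuotient_fixedSubring (S := UnitaryRing G) unitaryRingAct

theorem quotientMapNG_unitaryQuotientι :
    quotientMapNG G ≫ unitaryQuotientι G = unitaryι G ≫ quotientMapUG G :=
  specMap_subtype_fixedSubringMap _ _

theorem quotientMapUG_unitQuotientι :
    quotientMapUG G ≫ unitQuotientι G = unitι G ≫ quotientMapPV G :=
  specMap_subtype_unitQuotientι

end UnitRing

/-! ### Galois algebras with a normal basis -/

section NormalBasis

variable {G : Type u} [Group G] {R : Type u} [CommRing R] {S : Type u} [CommRing S] [Algebra R S]
variable [MulSemiringAction G S] [SMulCommClass G R S]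

variable (G R S) in
/-- The torsor map as a homomorphism of algebras over the first factor. -/
def torsorAlgHom : S ⊗[R] S →ₐ[S] (G → S) :=
  AlgHom.ofLinearMap
    { (torsorMap G R S).toLinearMap with
      map_smul' := fun s z => by
        change torsorMap G R S (s • z) = s • torsorMap G R S z
        induction z with
        | zero => rw [smul_zero, map_zero, smul_zero]
        | tmul a b =>
          ext g
          rw [TensorProduct.smul_tmul', Pi.smul_apply, torsorMap_tmul, torsorMap_tmul, smul_eq_mul,
            smul_eq_mul, mul_assoc]
        | add a b ha hb => rw [smul_add, map_add, ha, hb, map_add, smul_add] }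
    (map_one (torsorMap G R S)) (map_mul (torsorMap G R S))

theorem torsorAlgHom_apply (z : S ⊗[R] S) : torsorAlgHom G R S z = torsorMap G R S z := rfl

/-- The trace commutes with the base change to `S`, where the torsor map turns `S ⊗ S` into `G → S`
and multiplication by `1 ⊗ s` into the diagonal matrix with entries `g • s`. -/
theorem algebraMap_trace_eq_sum [Fintype G] [Module.Free R S] [Module.Finite R S]
    (h : Function.Bijective (torsorMap G R S)) (s : S) :
    algebraMap R S (Algebra.trace R S s) = ∑ g : G, g • s := by
  classical
  let e : S ⊗[R] S ≃ₐ[S] (G → S) := AlgEquiv.ofBijective (torsorAlgHom G R S) h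
  rw [← trace_baseChange' S s, ← Algebra.trace_eq_of_algEquiv e,
    Algebra.trace_eq_matrix_trace (Pi.basisFun S G), Matrix.trace]
  refine Finset.sum_congr rfl fun g _ => ?_
  rw [Matrix.diag_apply, Algebra.leftMulMatrix_eq_repr_mul]
  have : e (1 ⊗ₜ s) g = g • s := (torsorMap_tmul 1 s g).trans (one_mul _)
  simp [this]

variable [Fintype G] [DecidableEq G]

theorem toMatrix_torsorAlgHom (b : Module.Basis G R S) {x : S} (hb : ∀ g, b g = g • x) :
    LinearMap.toMatrix (b.baseChange S) (Pi.basisFun S G) (torsorAlgHom G R S).toLinearMap =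
      Matrix.of fun g h : G => (g * h) • x := by
  ext g h
  rw [LinearMap.toMatrix_apply]
  simp [torsorAlgHom_apply, torsorMap_tmul, hb, mul_smul]

/-- The torsor map is `S`-linear in the first factor, and `((g * h) • x)` is its matrix with respect
to the basis `1 ⊗ (h • x)` and the standard basis of `G → S`. -/
theorem bijective_torsorMap_iff (b : Module.Basis G R S) {x : S} (hb : ∀ g, b g = g • x) :
    Function.Bijective (torsorMap G R S) ↔
      IsUnit (Matrix.of fun g h : G => (g * h) • x).det := by
  rw [← toMatrix_torsorAlgHom b hb]
  constructor
  · intro h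
    exact LinearEquiv.isUnit_det
      (AlgEquiv.ofBijective (torsorAlgHom G R S) h).toLinearEquiv (b.baseChange S) (Pi.basisFun S G)
  · intro h
    exact (LinearEquiv.ofIsUnitDet h).bijective

/-- A nontrivial free module is faithfully flat, so étaleness descends along `R → S` from `S ⊗ S`,
which the torsor map identifies with a finite product of copies of `S`. -/
theorem IsGaloisAlgebra.of_basis [Nontrivial S] (b : Module.Basis G R S) {x : S}
    (hb : ∀ g, b g = g • x) (h : IsUnit (Matrix.of fun g h : G => (g * h) • x).det) :
    IsGaloisAlgebra G R S := by
  have hbij := (bijective_torsorMap_iff b hb).mpr h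
  have hfree := Module.Free.of_basis b
  have hflat : Module.FaithfullyFlat R S := inferInstance
  have : Algebra.Etale S (S ⊗[R] S) :=
    .of_equiv (AlgEquiv.ofBijective (torsorAlgHom G R S) hbij).symm
  exact ⟨.of_etale_tensorProduct_of_faithfullyFlat S, hflat, hbij⟩

/-- If the matrix of the conjugates of `x` is invertible, then these form a basis over the ring of
invariants. -/
theorem exists_basis_of_isUnit_det (hinj : Function.Injective (algebraMap R S))
    (hR : ∀ s : S, (∀ g : G, g • s = s) → s ∈ Set.range (algebraMap R S)) {x : S}
    (h : IsUnit (Matrix.of fun g h : G => (g * h) • x).det) :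
    ∃ b : Module.Basis G R S, ∀ g, b g = g • x := by
  let M : Matrix G G S := Matrix.of fun g h : G => (g * h) • x
  have hMinj : Function.Injective M.mulVec :=
    Matrix.mulVec_injective_of_isUnit (M.isUnit_iff_isUnit_det.mpr h)
  have hMv (c : G → S) (g : G) : M.mulVec c g = ∑ l, (g * l) • x * c l := rfl
  have hli : LinearIndependent R fun g : G => g • x := by
    rw [Fintype.linearIndependent_iff]
    intro c hc g
    -- Applying every `k` to one linear relation produces the whole system `M c = 0`.
    have : (fun g => algebraMap R S (c g)) = 0 := hMinj (by
      ext k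
      rw [Matrix.mulVec_zero, Pi.zero_apply]
      have h' := congrArg (k • ·) hc
      simp only [smul_zero, Finset.smul_sum, smul_comm k, smul_smul] at h'
      rw [← h', hMv]
      exact Finset.sum_congr rfl fun l _ => by rw [Algebra.smul_def, mul_comm])
    exact hinj ((congrFun this g).trans (map_zero _).symm)
  have hsp : ⊤ ≤ Submodule.span R (Set.range fun g : G => g • x) := by
    intro s _
    -- Cramer's rule over `S`: the row of index `1` of `M c = (g • s)` expands `s` in the conjugates
    -- of `x`, with coefficients so far only in `S`.
    let c : G → S := M⁻¹.mulVec fun g => g • s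
    have hc : M.mulVec c = fun g => g • s := by
      rw [Matrix.mulVec_mulVec, Matrix.mul_nonsing_inv _ h, Matrix.one_mulVec]
    -- Applying `k` to the row of index `k⁻¹ * g` shows that `k • c` solves the same system, so by
    -- uniqueness the coefficients are invariant and come from `R`.
    have hinv (k l : G) : k • c l = c l := by
      have : (fun l => k • c l) = c := hMinj (by
        rw [hc]
        ext g
        have h' := congrArg (k • ·) (congrFun hc (k⁻¹ * g))
        simp only [smul_smul, mul_inv_cancel_left] at h'
        rw [← h', hMv, hMv, Finset.smul_sum]
        refine Finset.sum_congr rfl fun l _ => ?_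
        rw [smul_mul', smul_smul, mul_assoc, mul_inv_cancel_left])
      exact congrFun this l
    have hs : s = ∑ l, c l * l • x := by
      have h' := congrFun hc 1
      rw [hMv, one_smul] at h'
      rw [← h']
      exact Finset.sum_congr rfl fun l _ => by rw [one_mul, mul_comm]
    rw [hs]
    refine sum_mem fun l _ => ?_
    obtain ⟨r, hr⟩ := hR (c l) fun k => hinv k l
    rw [← hr, ← Algebra.smul_def]
    exact Submodule.smul_mem _ _ (Submodule.subset_span ⟨l, rfl⟩)
  exact ⟨Module.Basis.mk hli hsp, fun g => by simp⟩

end NormalBasis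

/-! ### Invariants, traces and self-duality of a normal pair. -/

section NormalPair

variable {G : Type u} [Group G] {R : Type u} [CommRing R]

theorem NormalPair.algebraMap_injective (P : NormalPair G R) :
    Function.Injective (algebraMap R P.S) := by
  obtain ⟨b, -⟩ := P.isNormal.basis_exists
  refine (injective_iff_map_eq_zero _).mpr fun r hr => ?_
  have : r • b 1 = 0 := by rw [Algebra.smul_def, hr, zero_mul]
  simpa using congr(b.repr $this 1)

variable [Fintype G]

theorem NormalPair.algebraMap_trace (P : NormalPair G R) (s : P.S) :
    algebraMap R P.S (Algebra.trace R P.S s) = ∑ g : G, g • s := by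
  have := P.isNormal.free
  have := P.isNormal.finite
  exact algebraMap_trace_eq_sum P.isGalois.bijective_torsorMap s

theorem NormalPair.sum_smul_x (P : NormalPair G R) : ∑ g : G, g • P.x = 1 := by
  rw [← P.algebraMap_trace, P.isNormal.trace_eq_one, map_one]

/-- An invariant element has equal coordinates in the normal basis, hence is a scalar times the sum
of the conjugates of `x`, which is one. -/
theorem NormalPair.mem_range_algebraMap (P : NormalPair G R) {s : P.S} (hs : ∀ g : G, g • s = s) :
    s ∈ (algebraMap R P.S).range := by
  obtain ⟨b, hb⟩ := P.isNormal.basis_exists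
  have hc (g k : G) : b.repr s (g * k) = b.repr s k := by
    have h : s = ∑ l, b.repr s l • b (g * l) := by
      conv_lhs => rw [← hs g, ← b.sum_repr s, Finset.smul_sum]
      simp only [smul_comm g, hb, smul_smul]
    conv_lhs => rw [h]
    classical simp [Finsupp.single_apply]
  refine ⟨b.repr s 1, ?_⟩
  rw [← mul_one (algebraMap R P.S _), ← P.sum_smul_x, Finset.mul_sum]
  nth_rw 2 [← b.sum_repr s]
  refine Finset.sum_congr rfl fun g _ => ?_
  rw [← hb, ← Algebra.smul_def, ← hc g 1, mul_one]

theorem NormalPair.isUnit_det [DecidableEq G] (P : NormalPair G R) :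
    IsUnit (Matrix.of fun g h : G => (g * h) • P.x).det := by
  obtain ⟨b, hb⟩ := P.isNormal.basis_exists
  exact (bijective_torsorMap_iff b hb).mp P.isGalois.bijective_torsorMap

/-- Since `R` embeds in `S` and the trace is the sum of conjugates, self-duality becomes a
polynomial identity in the conjugates of `x`, which can be compared with the equations of `N_G`. -/
theorem NormalPair.isSelfDual_iff [DecidableEq G] (P : NormalPair G R) :
    IsSelfDual G R P.x ↔
      ∀ g : G, ∑ h : G, h • P.x * (h * g) • P.x = if g = 1 then 1 else 0 := by
  refine forall_congr' fun g => ?_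
  rw [← P.algebraMap_injective.eq_iff, P.algebraMap_trace, apply_ite (algebraMap R P.S), map_one,
    map_zero]
  simp only [smul_mul', smul_smul]

end NormalPair

/-! ### The universal pair -/

section OfInvariants

variable {G : Type u} [Group G] {S : Type u} [CommRing S]

/-- The action given by a family of endomorphisms. -/
@[reducible] def actionOfHoms (ρ : G → S →+* S) (h_one : ∀ a, ρ 1 a = a)
    (h_mul : ∀ g h a, ρ (g * h) a = ρ g (ρ h a)) : MulSemiringAction G S where
  smul g := ρ g
  one_smul := h_one
  mul_smul := h_mul
  smul_zero g := map_zero (ρ g)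
  smul_add g := map_add (ρ g)
  smul_one g := map_one (ρ g)
  smul_mul g := map_mul (ρ g)

/-- The pair over the ring of invariants of `S` given by an element `x` of `S` whose conjugates sum
to one and have an invertible matrix. -/
def NormalPair.ofInvariants [Fintype G] [DecidableEq G] [Nontrivial S] (ρ : G → S →+* S)
    (h_one : ∀ a, ρ 1 a = a) (h_mul : ∀ g h a, ρ (g * h) a = ρ g (ρ h a)) (x : S)
    (hsum : ∑ g, ρ g x = 1) (hdet : IsUnit (Matrix.of fun g h : G => ρ (g * h) x).det) :
    NormalPair G (fixedSubring ρ) :=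
  letI := actionOfHoms ρ h_one h_mul
  have : SMulCommClass G (fixedSubring ρ) S := ⟨fun g a b => by
    change ρ g (a.1 * b) = a.1 * ρ g b
    rw [map_mul, a.2 g]⟩
  have hb := exists_basis_of_isUnit_det (G := G) (R := fixedSubring ρ) (S := S)
    Subtype.val_injective (fun s hs => ⟨⟨s, hs⟩, rfl⟩) hdet
  have hgal : IsGaloisAlgebra G (fixedSubring ρ) S :=
    let ⟨b, hb⟩ := hb
    .of_basis b hb hdet
  { S := S
    x := x
    isGalois := hgal
    isNormal := by
      obtain ⟨b, hb⟩ := hb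
      have hfree := Module.Free.of_basis b
      have hfin := Module.Finite.of_basis b
      have hfun : (fun g : G => g • x) = b := funext fun g => (hb g).symm
      refine ⟨Subtype.val_injective ?_, ?_, ?_⟩
      · exact (algebraMap_trace_eq_sum hgal.bijective_torsorMap _).trans hsum
      · rw [hfun]
        exact b.linearIndependent
      · rw [hfun]
        exact b.span_eq }

end OfInvariants

section Universal

variable {G : Type u} [Group G] [Fintype G] [DecidableEq G]

theorem coord_eq_unitRingAct (g : G) : coord g = unitRingAct g⁻¹ (coord 1) := by
  rw [unitRingAct_coord, one_mul, inv_inv]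

/-- The identity of `R[G]` is a point of `U_G`, so `A` maps to a nontrivial ring. This feeds the
faithful flatness of the universal algebra. -/
theorem nontrivial_unitRing (R : Type u) [CommRing R] [Nontrivial R] :
    Nontrivial (UnitRing G) := by
  have h : (Matrix.of fun g h : G => if g * h = 1 then (1 : R) else 0) =
      (1 : Matrix G G R).submatrix id (Equiv.inv G) := by
    ext g h
    simp [Matrix.one_apply, mul_eq_one_iff_eq_inv]
  have hdet : IsUnit (Matrix.of fun g h : G => if g * h = 1 then (1 : R) else 0).det := by
    rw [h, Matrix.det_permute', Matrix.det_one, mul_one]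
    exact (Equiv.Perm.sign _).isUnit.map (Int.castRingHom R)
  exact (UnitRing.lift (fun g : G => if g = 1 then 1 else 0) hdet (by simp)).domain_nontrivial

instance : Nontrivial (UnitRing G) := nontrivial_unitRing (ULift ℤ)

/-- As `(g * h)⁻¹ = h⁻¹ * g⁻¹`, the matrices differ by a transposition and a simultaneous
reindexing. The inverse arises because `g` sends `coord 1` to `coord g⁻¹`. -/
theorem isUnit_det_inv_iff {S : Type*} [CommRing S] (a : G → S) :
    IsUnit (Matrix.of fun g h : G => a (g * h)⁻¹).det ↔
      IsUnit (Matrix.of fun g h : G => a (g * h)).det := by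
  have h : (Matrix.of fun g h : G => a (g * h)⁻¹) =
      ((Matrix.of fun g h : G => a (g * h)).transpose).submatrix (Equiv.inv G) (Equiv.inv G) := by
    ext g h
    simp
  rw [h, Matrix.det_submatrix_equiv_self, Matrix.det_transpose]

variable (G) in
/-- The universal pair, over the ring of functions of `U_G/G`. -/
def universalPair : NormalPair G (UnitInvariants G) :=
  .ofInvariants unitRingAct unitRingAct_one unitRingAct_mul (coord 1) sum_unitRingAct_coord_one (by
    simp only [unitRingAct_coord, one_mul]
    exact (isUnit_det_inv_iff coord).mpr (isUnit_det_coord G))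

variable {R : Type u} [CommRing R]

/-- The equivariant homomorphism `A → S` given by a pair `(S, x)`. -/
theorem NormalPair.exists_unitRing_hom (P : NormalPair G R) :
    ∃ φ : UnitRing G →+* P.S, (∀ (g : G) a, φ (unitRingAct g a) = g • φ a) ∧ φ (coord 1) = P.x := by
  let φ : UnitRing G →+* P.S := UnitRing.lift (fun g => g⁻¹ • P.x)
    ((isUnit_det_inv_iff fun g => g • P.x).mpr P.isUnit_det)
    ((Equiv.sum_comp (Equiv.inv G) fun g => g • P.x).trans P.sum_smul_x)
  have hφ (g : G) : φ (coord g) = g⁻¹ • P.x := UnitRing.lift_coord ..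
  refine ⟨φ, fun g a => ?_, by rw [hφ, inv_one, one_smul]⟩
  have : φ.comp (unitRingAct g) = (MulSemiringAction.toRingHom G P.S g).comp φ :=
    UnitRing.hom_ext fun k => by
      rw [RingHom.comp_apply, RingHom.comp_apply, unitRingAct_coord, hφ, hφ,
        MulSemiringAction.toRingHom_apply, smul_smul, mul_inv_rev, inv_inv]
  exact congr($this a)

theorem equivariant_hom_ext {S : Type u} [CommRing S] [MulSemiringAction G S]
    {φ ψ : UnitRing G →+* S} (hφ : ∀ (g : G) a, φ (unitRingAct g a) = g • φ a)
    (hψ : ∀ (g : G) a, ψ (unitRingAct g a) = g • ψ a) (h : φ (coord 1) = ψ (coord 1)) : φ = ψ :=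
  UnitRing.hom_ext fun g => by rw [coord_eq_unitRingAct, hφ, hψ, h]

/-- An equivariant homomorphism from `A` to a Galois algebra induces a homomorphism of the rings
of invariants. -/
theorem NormalPair.exists_hom_invariants (P : NormalPair G R) (φ : UnitRing G →+* P.S)
    (hφ : ∀ (g : G) a, φ (unitRingAct g a) = g • φ a) :
    ∃ ψ : UnitInvariants G →+* R, ∀ a, φ a.1 = algebraMap R P.S (ψ a) := by
  let e : R ≃+* (algebraMap R P.S).range := .ofBijective (algebraMap R P.S).rangeRestrict
    ⟨fun a b h => P.algebraMap_injective congr(($h).1), (algebraMap R P.S).rangeRestrict_surjective⟩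
  refine ⟨e.symm.toRingHom.comp ((φ.comp (fixedSubring unitRingAct).subtype).codRestrict _
    fun a => P.mem_range_algebraMap fun g => ?_), fun a => ?_⟩
  · exact (hφ g a.1).symm.trans (congrArg φ (a.2 g))
  · exact (congrArg Subtype.val (e.apply_symm_apply ⟨φ a.1, _⟩)).symm

/-- The equivariant map `A → S` carries invariants into `R`, and the induced map from the base
change of `A` to `S` takes one normal basis to the other, so it is automatically an isomorphism. -/
theorem exists_baseChange_universalPair (P : NormalPair G R) :
    ∃ ψ : UnitInvariants G →+* R, ((universalPair G).baseChange ψ).Isomorphic P := by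
  obtain ⟨φ, hφ, hx⟩ := P.exists_unitRing_hom
  obtain ⟨ψ, hψ⟩ := P.exists_hom_invariants φ hφ
  exact ⟨ψ, NormalPair.baseChange_isomorphic ψ (universalPair G) P φ hψ hφ hx⟩

/-- The structure map of the base change of the universal pair. -/
theorem exists_hom_of_isomorphic {P : NormalPair G R} {ψ : UnitInvariants G →+* R}
    (h : ((universalPair G).baseChange ψ).Isomorphic P) :
    ∃ φ : UnitRing G →+* P.S, (∀ (g : G) a, φ (unitRingAct g a) = g • φ a) ∧ φ (coord 1) = P.x ∧
      ∀ a : UnitInvariants G, φ a.1 = algebraMap R P.S (ψ a) := by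
  obtain ⟨φ, h₁, h₂, h₃⟩ := (universalPair G).baseChange_map ψ
  obtain ⟨e, he, hx⟩ := h
  refine ⟨(e : _ →+* P.S).comp φ, fun g a => ?_, ?_, fun a => ?_⟩
  · exact (congrArg e (h₂ g a)).trans (he g _)
  · exact (congrArg e h₃).trans hx
  · exact (congrArg e (h₁ a)).trans (e.commutes _)

/-- An equivariant map `A → S` is determined by the image of `coord 1`, as the coordinates form a
single orbit; the point of `U_G/G` is its restriction to invariants, because `R` embeds in `S`. -/
theorem eq_of_baseChange_universalPair {P : NormalPair G R} {ψ ψ' : UnitInvariants G →+* R}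
    (h : ((universalPair G).baseChange ψ).Isomorphic P)
    (h' : ((universalPair G).baseChange ψ').Isomorphic P) : ψ = ψ' := by
  obtain ⟨φ, h₁, h₂, h₃⟩ := exists_hom_of_isomorphic h
  obtain ⟨φ', h₁', h₂', h₃'⟩ := exists_hom_of_isomorphic h'
  obtain rfl := equivariant_hom_ext h₁ h₁' (h₂.trans h₂'.symm)
  ext a
  exact P.algebraMap_injective ((h₃ a).symm.trans (h₃' a))

theorem NormalPair.isSelfDual_iff_of_hom (P : NormalPair G R) (φ : UnitRing G →+* P.S)
    (hφ : ∀ (g : G) a, φ (unitRingAct g a) = g • φ a) (hx : φ (coord 1) = P.x) :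
    IsSelfDual G R P.x ↔
      ∀ g : G, ∑ h, φ (coord (g * h)) * φ (coord h) = if g = 1 then 1 else 0 := by
  have hc (g : G) : φ (coord g) = g⁻¹ • P.x := by rw [coord_eq_unitRingAct, hφ, hx]
  rw [P.isSelfDual_iff, ← (Equiv.inv G).forall_congr_right]
  refine forall_congr' fun g => ?_
  have h : ∑ h : G, h • P.x * (h * (Equiv.inv G) g) • P.x =
      ∑ h : G, φ (coord (g * h)) * φ (coord h) := by
    rw [← Equiv.sum_comp (Equiv.inv G)]
    refine Finset.sum_congr rfl fun k _ => ?_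
    rw [hc, hc, mul_comm, mul_inv_rev]
    rfl
  rw [h]
  simp only [Equiv.inv_apply, inv_eq_one]

/-- The pairs given by the points of `N_G/G` are self-dual. -/
theorem isSelfDual_of_factors {P : NormalPair G R} (θ : UnitaryInvariants G →+* R)
    (h : ((universalPair G).baseChange (θ.comp (invariantsToUnitary G))).Isomorphic P) :
    IsSelfDual G R P.x := by
  obtain ⟨φ, h₁, h₂, h₃⟩ := exists_hom_of_isomorphic h
  rw [P.isSelfDual_iff_of_hom φ h₁ h₂]
  intro g
  -- Each defining relation of `N_G` is itself invariant, hence an element of `A^G`, and it vanishes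
  -- in `B^G`.
  let a : UnitInvariants G := ⟨∑ h : G, coord (g * h) * coord h - if g = 1 then 1 else 0, by
    intro k
    rw [map_sub, apply_ite (unitRingAct k), map_one, map_zero, map_sum]
    simp only [map_mul, unitRingAct_coord, mul_assoc]
    congr 1
    exact Equiv.sum_comp (Equiv.mulRight k⁻¹) fun h => coord (g * h) * coord h⟩
  have ha : θ (invariantsToUnitary G a) = 0 := map_fixedSubringMap_eq_zero _ _ θ
    (Ideal.Quotient.eq_zero_iff_mem.mpr (Ideal.subset_span ⟨g, rfl⟩))
  have h := h₃ a
  rw [RingHom.comp_apply, ha, map_zero, map_sub, sub_eq_zero, apply_ite φ, map_one,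
    map_zero, map_sum] at h
  simpa only [map_mul] using h

/-- A point of `U_G/G` that gives a self-dual pair lies on `N_G/G`. -/
theorem factors_of_isSelfDual {P : NormalPair G R} {ψ : UnitInvariants G →+* R}
    (h : ((universalPair G).baseChange ψ).Isomorphic P) (hP : IsSelfDual G R P.x) :
    ∃ θ : UnitaryInvariants G →+* R, θ.comp (invariantsToUnitary G) = ψ := by
  obtain ⟨φ, h₁, h₂, h₃⟩ := exists_hom_of_isomorphic h
  rw [P.isSelfDual_iff_of_hom φ h₁ h₂] at hP
  -- An invariant `a` that dies in `B` must be killed by `ψ`. This is checked in `S`: by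
  -- self-duality `φ` factors through `B`, so `φ a = 0`. Generators of the kernel of `A^G → B^G` are
  -- not needed.
  refine exists_comp_fixedSubringMap_eq _ _ invariantsToUnitary_surjective ψ fun a ha => ?_
  refine P.algebraMap_injective ?_
  rw [← h₃, map_zero]
  exact (congrArg (UnitaryRing.lift φ hP) ha).trans (RingHom.map_zero (UnitaryRing.lift φ hP))

end Universal

/-! ### Representability of the moduli functors -/

section Representability

variable {G : Type u} [Group G] [Fintype G] [DecidableEq G]

theorem preimage_specMap_comp {R S T : CommRingCat.{u}} (f : R ⟶ S) (x : Spec R ⟶ Spec T) :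
    Spec.preimage (Spec.map f ≫ x) = Spec.preimage x ≫ f :=
  Spec.map_injective (by simp)

theorem preimage_comp_specMap {R S T : CommRingCat.{u}} (f : S ⟶ T) (x : Spec R ⟶ Spec T) :
    Spec.preimage (x ≫ Spec.map f) = f ≫ Spec.preimage x :=
  Spec.map_injective (by simp)

omit [Fintype G] [DecidableEq G] in
theorem NormalPair.Isomorphic.refl {R : Type u} [CommRing R] (P : NormalPair G R) :
    P.Isomorphic P :=
  ⟨AlgEquiv.refl, fun _ _ => rfl, rfl⟩

/-- The class of the base change of the universal pair. -/
def classOfHom {R : CommRingCat.{u}} (ψ : CommRingCat.of (UnitInvariants G) ⟶ R) :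
    (normalFunctor G).obj R :=
  (normalFunctor G).map ψ (Quotient.mk _ (universalPair G))

theorem classOfHom_comp {R R' : CommRingCat.{u}} (ψ : CommRingCat.of (UnitInvariants G) ⟶ R)
    (f : R ⟶ R') : classOfHom (ψ ≫ f) = (normalFunctor G).map f (classOfHom ψ) := by
  rw [classOfHom, Functor.map_comp]
  rfl

theorem classOfHom_bijective (R : CommRingCat.{u}) :
    Function.Bijective (classOfHom (G := G) (R := R)) := by
  refine ⟨fun ψ ψ' h => ?_, fun q => ?_⟩
  · ext1
    exact eq_of_baseChange_universalPair (Quotient.exact h) (.refl _)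
  · induction q using Quotient.inductionOn with
    | _ P =>
      obtain ⟨ψ, hψ⟩ := exists_baseChange_universalPair P
      exact ⟨CommRingCat.ofHom ψ, Quotient.sound hψ⟩

theorem classOfHom_mem_selfDual {R : CommRingCat.{u}}
    (θ : CommRingCat.of (UnitaryInvariants G) ⟶ R) :
    classOfHom (CommRingCat.ofHom (invariantsToUnitary G) ≫ θ) ∈ (selfDualSubfunctor G).obj R :=
  ⟨_, isSelfDual_of_factors θ.hom (.refl _), rfl⟩

/-- The self-dual class given by a homomorphism out of the ring of functions of `N_G/G`. -/
def selfDualClassOfHom {R : CommRingCat.{u}} (θ : CommRingCat.of (UnitaryInvariants G) ⟶ R) :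
    (selfDualSubfunctor G).obj R :=
  ⟨_, classOfHom_mem_selfDual θ⟩

/-- Injectivity comes from that of `classOfHom` and the surjectivity of `A^G → B^G`; surjectivity is
the factorization of self-dual points through `B^G`. -/
theorem selfDualClassOfHom_bijective (R : CommRingCat.{u}) :
    Function.Bijective (selfDualClassOfHom (G := G) (R := R)) := by
  refine ⟨fun θ θ' h => ?_, ?_⟩
  · have h' := (classOfHom_bijective R).injective (congrArg Subtype.val h)
    ext1
    exact (RingHom.cancel_right invariantsToUnitary_surjective).mp congr(($h').hom)
  · rintro ⟨q, hq⟩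
    obtain ⟨ψ, rfl⟩ := (classOfHom_bijective R).surjective q
    obtain ⟨θ, hθ⟩ := factors_of_isSelfDual (ψ := ψ.hom) (.refl _)
      ((mk_mem_selfDualSubfunctor G R _).mp hq)
    refine ⟨CommRingCat.ofHom θ, Subtype.ext (congrArg classOfHom ?_)⟩
    ext1
    exact hθ

variable (G) in
/-- `U_G/G` represents the functor of pairs. -/
def pointsUnitIso : points.obj (Spec (.of (UnitInvariants G))) ⋙ uliftFunctor.{u + 1} ≅
    normalFunctor G :=
  NatIso.ofComponents
    (fun R => (((Equiv.ulift.trans Spec.homEquiv).trans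
      (Equiv.ofBijective _ (classOfHom_bijective R))).toIso)) fun {R R'} f => by
    ext ⟨x⟩
    refine Eq.trans (congrArg classOfHom ?_) (classOfHom_comp (Spec.preimage x) f)
    exact preimage_specMap_comp f x

variable (G) in
/-- `N_G/G` represents the functor of self-dual pairs. -/
def pointsUnitaryIso : points.obj (Spec (.of (UnitaryInvariants G))) ⋙ uliftFunctor.{u + 1} ≅
    (selfDualSubfunctor G).toFunctor :=
  NatIso.ofComponents
    (fun R => (((Equiv.ulift.trans Spec.homEquiv).trans
      (Equiv.ofBijective _ (selfDualClassOfHom_bijective R))).toIso)) fun {R R'} f => by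
    ext ⟨x⟩
    refine Subtype.ext (Eq.trans (congrArg classOfHom ?_)
      (classOfHom_comp (CommRingCat.ofHom (invariantsToUnitary G) ≫ Spec.preimage x) f))
    exact (congrArg (_ ≫ ·) (preimage_specMap_comp f x)).trans (Category.assoc _ _ _).symm

theorem pointsUnitaryIso_comp_ι :
    (pointsUnitaryIso G).hom ≫ (selfDualSubfunctor G).ι =
      Functor.whiskerRight (points.map (unitaryQuotientι G)) uliftFunctor.{u + 1} ≫
        (pointsUnitIso G).hom := by
  ext R ⟨x⟩
  exact congrArg classOfHom
    (preimage_comp_specMap (CommRingCat.ofHom (invariantsToUnitary G)) x).symm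

end Representability

end NormalModuli

end

theorem theorem1p1 (G : Type u) [Group G] [Fintype G] [DecidableEq G] :
    -- `U_G` and `N_G` represent the unit group functors
    (∀ (R : Type u) [CommRing R],
      Set.BijOn (fun φ : UnitRing G →+* R => evalUnit φ) Set.univ (augUnits G R) ∧
      Set.BijOn (fun φ : UnitaryRing G →+* R => evalUnit (φ.comp (toUnitaryRing G))) Set.univ
        (unitaryUnits G R)) ∧
    -- the quotients `Q = P(V)/G`, `X = U_G/G` and `Y = N_G/G`
    ∃ (Q X Y : Scheme.{u}) (π : PV G ⟶ Q) (p : UG G ⟶ X) (q : NG G ⟶ Y) (j : X ⟶ Q) (i : Y ⟶ X),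
      IsQuotient projAct π ∧ IsQuotient unitAct p ∧ IsQuotient unitaryAct q ∧
      -- `X` and `Y` are affine subschemes of `Q`, compatibly with `N_G ⊂ U_G ⊂ P(V)`
      IsAffine X ∧ IsAffine Y ∧
      IsOpenImmersion (unitι G) ∧ IsOpenImmersion j ∧ IsClosedImmersion i ∧
      p ≫ j = unitι G ≫ π ∧ q ≫ i = unitaryι G ≫ p ∧
      -- `X` and `Y` represent the moduli functors, compatibly with the inclusions
      ∃ (e : points.obj X ⋙ uliftFunctor.{u + 1} ≅ normalFunctor G)
        (e' : points.obj Y ⋙ uliftFunctor.{u + 1} ≅ (selfDualSubfunctor G).toFunctor),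
        e'.hom ≫ (selfDualSubfunctor G).ι =
          Functor.whiskerRight (points.map i) uliftFunctor.{u + 1} ≫ e.hom :=
  ⟨fun R _ => ⟨bijOn_evalUnit G R, bijOn_evalUnit_unitary G R⟩,
    PVQuotient G, Spec (.of (UnitInvariants G)), Spec (.of (UnitaryInvariants G)),
    quotientMapPV G, quotientMapUG G, quotientMapNG G, unitQuotientι G, unitaryQuotientι G,
    isQuotient_quotientMapPV, isQuotient_quotientMapUG, isQuotient_quotientMapNG,
    inferInstance, inferInstance, isOpenImmersion_unitι, isOpenImmersion_unitQuotientι,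
    isClosedImmersion_unitaryQuotientι, quotientMapUG_unitQuotientι,
    quotientMapNG_unitaryQuotientι, pointsUnitIso G, pointsUnitaryIso G, pointsUnitaryIso_comp_ι⟩
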